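/- Identify the plane with $\mathbb{C}$. A generalized closed disc is a closed disc of positive radius, a closed half-plane, or the closed exterior $\{z : |z-c|\ge r\}$ of a circle ($r>0$). Two such discs are tangent if their interiors are disjoint and their boundaries meet in exactly one point (the point at infinity for two disjoint half-planes). Let $C_0$ be a circle with center $c_0$ and radius $r_0>0$, bounding the closed disc $D_0$. For a generalized disc $D$ tangent to $D_0$, let $\alpha(D)$, defined modulo $2\pi$, be the angle such that $D$ touches $D_0$ at $c_0+r_0e^{i\alpha(D)}$. Let $D_1,D_2$ be tangent generalized discs, both tangent to $D_0$, with angles represented by $\theta_1<\theta_2<\theta_1+2\pi$. For tangent $D,D'$, both tangent to $D_0$, whose angles have representatives $\theta<\theta'$ in $[\theta_1,\theta_2]$, the successor $s(D,D')$ is the generalized disc that is tangent to $D_0$, $D$ and $D'$ and has an angle strictly between $\theta$ and $\theta'$. Let $\mathcal{C}$ be the smallest family containing $D_1,D_2$ and containing $s(D,D')$ for all tangent $D,D'\in\mathcal{C}$; the angles of its members are taken in $[\theta_1,\theta_2]$. A continuous curve $\gamma:[\theta_1,\theta_2]\to\mathbb{C}$ is an Apollonian curve for $(C_0,D_1,D_2)$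 on $[\theta_1,\theta_2]$ if, for all tangent $D,D'\in\mathcal{C}$, $$\gamma(\alpha(D))-\gamma(\alpha(D'))\in\mathbb{R}\,e^{i\alpha(s(D,D'))/2}.$$ Let $D_1,D_2,D_3$ be pairwise tangent generalized discs, each tangent to $D_0$, with angles represented by $\theta_1<\theta_2<\theta_3<\theta_1+2\pi$. Let $\gamma_{12},\gamma_{23},\gamma_{31}$ be Apollonian curves for $(C_0,D_1,D_2)$, $(C_0,D_2,D_3)$, $(C_0,D_3,D_1)$ on $[\theta_1,\theta_2]$, $[\theta_2,\theta_3]$, $[\theta_3,\theta_1+2\pi]$, respectively, with $\gamma_{12}(\theta_2)=\gamma_{23}(\theta_2)$, $\gamma_{23}(\theta_3)=\gamma_{31}(\theta_3)$ and $\gamma_{31}(\theta_1+2\pi)=\gamma_{12}(\theta_1)$. The closed region enclosed by the three curves (the union of their images and of the bounded components of the complement of these images) is called an Apollonian triangle, and the three common endpoints are its vertices. Theorem. For any three points $v_1,v_2,v_3$ of the plane in general position (that is, not collinear), there is a unique Apollonian triangle whose vertices are $v_1,v_2,v_3$. -/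

import Mathlib

/-- Generalized closed discs in the plane `ℂ`: the closures of the components of the complement
of a generalized circle (a circle of positive radius or a line).  They are
* `ball c r`: the closed disc `{z | dist z c ≤ r}`,
* `half n t`: the closed half-plane `{z | t ≤ ⟪n, z⟫}` (with `n` a unit vector),
* `coball c r`: the closed exterior `{z | r ≤ dist z c}` of a circle. -/
inductive GDisc : Type
  | ball (c : ℂ) (r : ℝ) (hr : 0 < r) : GDisc
  | half (n : ℂ) (t : ℝ) (hn : ‖n‖ = 1) : GDisc
  | coball (c : ℂ) (r : ℝ) (hr : 0 < r) : GDisc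

namespace GDisc

/-- The generalized circle bounding a generalized closed disc. -/
def circle : GDisc → Set ℂ
  | ball c r _ => {z | dist z c = r}
  | half n t _ => {z | inner ℝ n z = t}
  | coball c r _ => {z | dist z c = r}

/-- Tangency of generalized closed discs: the interiors are disjoint and the boundary circles
touch at exactly one point, which is the point at infinity for two half-planes (bounded by
distinct parallel lines).  Written out by cases in terms of centres and radii.  Two bounded discs
are tangent iff their circles are externally tangent; a bounded disc and the exterior of a circle
are tangent iff the circle of the former is internally tangent to that of the latter; an exterior
always overlaps with half-planes and with other exteriors. -/
def Tangent : GDisc → GDisc → Prop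
  | ball c r _, ball c' r' _ => dist c c' = r + r'
  | ball c r _, half n t _ => inner ℝ n c = t - r
  | half n t _, ball c r _ => inner ℝ n c = t - r
  | ball c r _, coball c' r' _ => r < r' ∧ dist c c' = r' - r
  | coball c' r' _, ball c r _ => r < r' ∧ dist c c' = r' - r
  | half n t _, half n' t' _ => n' = -n ∧ 0 < t + t'
  | half _ _ _, coball _ _ _ => False
  | coball _ _ _, half _ _ _ => False
  | coball _ _ _, coball _ _ _ => False

end GDisc

/-- A proper circle (of positive radius) in the plane. -/
structure ProperCircle where
  center : ℂ
  radius : ℝ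
  radius_pos : 0 < radius

namespace ProperCircle

/-- The bounded closed disc of a proper circle. -/
def disc (C₀ : ProperCircle) : GDisc := GDisc.ball C₀.center C₀.radius C₀.radius_pos

/-- The point of `C₀` at angle `θ`. -/
noncomputable def point (C₀ : ProperCircle) (θ : ℝ) : ℂ :=
  C₀.center + C₀.radius * Complex.exp (θ * Complex.I)

/-- `D` is tangent to (the bounded disc of) `C₀`, at the point of `C₀` at angle `θ`.  If `D` is a
bounded disc with centre `c`, this `θ` is the angle of `c - C₀.center` with the positive axis. -/
def TouchesAt (C₀ : ProperCircle) (D : GDisc) (θ : ℝ) : Prop :=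
  C₀.disc.Tangent D ∧ C₀.point θ ∈ D.circle

end ProperCircle

/-- `S` is the successor of the pair `D, D'` of discs tangent to `C₀` at the angles `θ < θ'`: the
Soddy circle of `C₀, D, D'` (a circle tangent to all three) which touches `C₀` at an angle `φ`
strictly between `θ` and `θ'`, i.e. which lies in the region enclosed by the three circles that is
adjacent to the arc `(θ, θ')` of `C₀`. -/
structure IsSuccessor (C₀ : ProperCircle) (D : GDisc) (θ : ℝ) (D' : GDisc) (θ' : ℝ)
    (S : GDisc) (φ : ℝ) : Prop where
  left_lt : θ < φ
  lt_right : φ < θ'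
  touches : C₀.TouchesAt S φ
  tangent_left : S.Tangent D
  tangent_right : S.Tangent D'

/-- The smallest family of discs tangent to `C₀` (each recorded with its angle in `[θ₁, θ₂]`) which
contains `D₁, D₂` and is closed under adding successors of tangent pairs. -/
inductive ApollonianFamily (C₀ : ProperCircle) (D₁ : GDisc) (θ₁ : ℝ) (D₂ : GDisc) (θ₂ : ℝ) :
    GDisc → ℝ → Prop
  | left : ApollonianFamily C₀ D₁ θ₁ D₂ θ₂ D₁ θ₁
  | right : ApollonianFamily C₀ D₁ θ₁ D₂ θ₂ D₂ θ₂
  | successor {D : GDisc} {θ : ℝ} {D' : GDisc} {θ' : ℝ} {S : GDisc} {φ : ℝ}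
      (hD : ApollonianFamily C₀ D₁ θ₁ D₂ θ₂ D θ)
      (hD' : ApollonianFamily C₀ D₁ θ₁ D₂ θ₂ D' θ')
      (htan : D.Tangent D') (hS : IsSuccessor C₀ D θ D' θ' S φ) :
      ApollonianFamily C₀ D₁ θ₁ D₂ θ₂ S φ

/-- `γ`, restricted to `[θ₁, θ₂]`, is an Apollonian curve associated to `C₀, D₁, D₂`, where `D₁, D₂`
touch `C₀` at the angles `θ₁ < θ₂`: it is continuous and for every tangent pair `D, D'` of the
family, with successor touching `C₀` at angle `φ`, the chord `γ θ - γ θ'` is a real multiple of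
`exp (i φ / 2)`, a complex square root of the direction of the successor seen from the centre. -/
def IsApollonianCurve (C₀ : ProperCircle) (D₁ : GDisc) (θ₁ : ℝ) (D₂ : GDisc) (θ₂ : ℝ)
    (γ : ℝ → ℂ) : Prop :=
  ContinuousOn γ (Set.Icc θ₁ θ₂) ∧
  ∀ (D : GDisc) (θ : ℝ) (D' : GDisc) (θ' : ℝ) (S : GDisc) (φ : ℝ),
    ApollonianFamily C₀ D₁ θ₁ D₂ θ₂ D θ → ApollonianFamily C₀ D₁ θ₁ D₂ θ₂ D' θ' →
    D.Tangent D' → IsSuccessor C₀ D θ D' θ' S φ →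
    ∃ t : ℝ, γ θ - γ θ' = t * Complex.exp ((φ / 2 : ℝ) * Complex.I)

/-- The closed region enclosed by a set `K`: `K` with all bounded components of its complement. -/
def enclosedRegion (K : Set ℂ) : Set ℂ :=
  K ∪ {z | z ∉ K ∧ Bornology.IsBounded (connectedComponentIn Kᶜ z)}

/-- The data of an Apollonian triangle: a proper circle `C₀` and three pairwise tangent discs
`D₁, D₂, D₃` tangent to `C₀` (so that all four discs have disjoint interiors), labelled in
counterclockwise order of their angles on `C₀`; and for each of the three arcs into which the
tangency points divide `C₀` an Apollonian curve, consecutive curves having a common endpoint. -/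
structure IsApollonianConfiguration (C₀ : ProperCircle) (D₁ D₂ D₃ : GDisc) (θ₁ θ₂ θ₃ : ℝ)
    (γ₁₂ γ₂₃ γ₃₁ : ℝ → ℂ) : Prop where
  touches₁ : C₀.TouchesAt D₁ θ₁
  touches₂ : C₀.TouchesAt D₂ θ₂
  touches₃ : C₀.TouchesAt D₃ θ₃
  tangent₁₂ : D₁.Tangent D₂
  tangent₂₃ : D₂.Tangent D₃
  tangent₃₁ : D₃.Tangent D₁
  lt₁₂ : θ₁ < θ₂
  lt₂₃ : θ₂ < θ₃
  lt₃₁ : θ₃ < θ₁ + 2 * Real.pi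
  curve₁₂ : IsApollonianCurve C₀ D₁ θ₁ D₂ θ₂ γ₁₂
  curve₂₃ : IsApollonianCurve C₀ D₂ θ₂ D₃ θ₃ γ₂₃
  curve₃₁ : IsApollonianCurve C₀ D₃ θ₃ D₁ (θ₁ + 2 * Real.pi) γ₃₁
  vertex₂ : γ₁₂ θ₂ = γ₂₃ θ₂
  vertex₃ : γ₂₃ θ₃ = γ₃₁ θ₃
  vertex₁ : γ₃₁ (θ₁ + 2 * Real.pi) = γ₁₂ θ₁

/-- `T` is an Apollonian triangle with vertex set `V`: the region enclosed by the three Apollonian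
curves of some configuration, whose common endpoints are the points of `V`. -/
def IsApollonianTriangle (T V : Set ℂ) : Prop :=
  ∃ (C₀ : ProperCircle) (D₁ D₂ D₃ : GDisc) (θ₁ θ₂ θ₃ : ℝ) (γ₁₂ γ₂₃ γ₃₁ : ℝ → ℂ),
    IsApollonianConfiguration C₀ D₁ D₂ D₃ θ₁ θ₂ θ₃ γ₁₂ γ₂₃ γ₃₁ ∧
    V = {γ₁₂ θ₁, γ₂₃ θ₂, γ₃₁ θ₃} ∧
    T = enclosedRegion (γ₁₂ '' Set.Icc θ₁ θ₂ ∪ γ₂₃ '' Set.Icc θ₂ θ₃ ∪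
      γ₃₁ '' Set.Icc θ₃ (θ₁ + 2 * Real.pi))

/-!
Let `C₀` have radius `r₀`. A disc touching `C₀` at angle `θ` is recorded by its spinor
`√k e^{iθ/2}`, where `k = 1 + r₀ κ` and `κ` is the signed curvature of the disc. Two discs touching
`C₀` are tangent iff the area form of their spinors is `±1`, and the spinor of a successor is the
sum of the spinors of its parents. So the discs of the family generated by two discs with spinors
`u` and `w` correspond to the vectors `p u + q w` with coprime `p, q ≥ 0`, the angles of these discs
are dense, and the condition on the chords determines an Apollonian curve by its endpoints `a` and
`b`. If `a = g - t u` and `b = g + t w`, the curve is the affine image, determined by `a`, `b` and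
`g`, of one universal self-affine curve indexed by Farey fractions.

For three discs the spinors can be taken to be `u`, `w` and `w - u`. That the three chords add up to
zero forces the control point `g` of all three curves to be the centroid of the vertices, so the
boundary of the triangle depends only on the vertices. Conversely, any `u` and `w` with area form
`1` occur as spinors, which gives existence.
-/

open Set
open scoped Real RealInnerProductSpace

attribute [local instance] Complex.finrank_real_complex_fact

/-- The standard area form of the plane, `ω z w = Im (z̄ w)`. -/
local notation "ω" => Orientation.areaForm Complex.orientation

section AreaForm

lemma areaForm_self_eq_zero (z : ℂ) : ω z z = 0 :=
  Complex.orientation.areaForm_apply_self z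

lemma areaForm_smul_eq_add (u w z : ℂ) : ω u w • z = ω z w • u + ω u z • w := by
  apply Complex.ext <;>
    simp only [Complex.areaForm, Complex.mul_im, Complex.conj_re, Complex.conj_im, Complex.smul_re,
      Complex.smul_im, Complex.add_re, Complex.add_im, smul_eq_mul] <;>
    ring

lemma exists_eq_smul_of_areaForm_eq_zero {u w : ℂ} (hu : u ≠ 0) (h : ω u w = 0) :
    ∃ r : ℝ, w = r • u := by
  have hcramer := areaForm_smul_eq_add u w (Complex.orientation.rightAngleRotation u)
  rw [h, zero_smul, Orientation.areaForm_rightAngleRotation_left,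
    Orientation.areaForm_rightAngleRotation_right, real_inner_self_eq_norm_sq] at hcramer
  refine ⟨(‖u‖ ^ 2)⁻¹ * ⟪u, w⟫, ?_⟩
  rw [mul_smul, eq_inv_smul_iff₀ (pow_ne_zero 2 (norm_ne_zero_iff.2 hu))]
  linear_combination (norm := module) -hcramer

lemma areaForm_mul_areaForm (u w z z' : ℂ) :
    ω u w * ω z z' = ω z w * ω u z' - ω u z * ω z' w := by
  simp only [Complex.areaForm, Complex.mul_im, Complex.conj_re, Complex.conj_im]
  ring

lemma areaForm_eq_neg_three_mul_of_add_add_eq {a b c g : ℂ} (hg : a + b + c = (3 : ℝ) • g) :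
    ω (b - a) (c - a) = -3 * ω (g - a) (b - g) := by
  obtain rfl : c = (3 : ℝ) • g - a - b := by rw [← hg]; ring
  simp only [Complex.areaForm, Complex.mul_im, Complex.conj_re, Complex.conj_im, Complex.sub_re,
    Complex.sub_im, Complex.smul_re, Complex.smul_im, smul_eq_mul]
  ring

end AreaForm

section InnerProductSpace

variable {F : Type*} [NormedAddCommGroup F] [InnerProductSpace ℝ F] {e e' : F}

lemma norm_sq_smul_sub_smul (he : ‖e‖ = 1) (he' : ‖e'‖ = 1) (x y : ℝ) :
    ‖x • e - y • e'‖ ^ 2 = (x - y) ^ 2 + 2 * x * y * (1 - ⟪e, e'⟫) := by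
  rw [norm_sub_sq_real, norm_smul, norm_smul, real_inner_smul_left, real_inner_smul_right, he, he',
    Real.norm_eq_abs, Real.norm_eq_abs, mul_one, mul_one, sq_abs, sq_abs]
  ring

lemma eq_smul_iff_norm_sq_eq {a r : ℝ} (ha : a ≠ 0) (he : ‖e‖ = 1) {d : F} :
    d = (a + r) • e ↔ ‖d‖ ^ 2 = (a + r) ^ 2 ∧ ‖a • e - d‖ ^ 2 = r ^ 2 := by
  constructor
  · rintro rfl
    rw [norm_sq_smul_sub_smul he he, real_inner_self_eq_norm_sq, norm_smul, mul_pow,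
      Real.norm_eq_abs, sq_abs, he]
    constructor <;> ring
  · rintro ⟨hd, hr⟩
    have hinner : ⟪e, d⟫ = a + r := by
      rw [norm_sub_sq_real, norm_smul, real_inner_smul_left, he, hd, Real.norm_eq_abs, mul_one,
        sq_abs] at hr
      refine mul_left_cancel₀ ha ?_
      linarith
    have hzero : ‖d - (a + r) • e‖ ^ 2 = 0 := by
      rw [norm_sub_sq_real, norm_smul, real_inner_smul_right, real_inner_comm, hinner, hd, he,
        Real.norm_eq_abs, mul_one, sq_abs]
      ring
    exact sub_eq_zero.1 (norm_eq_zero.1 (pow_eq_zero_iff two_ne_zero |>.1 hzero))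

end InnerProductSpace

section HalfDir

/-- The unit vector whose argument is half of `θ`. -/
noncomputable def halfDir (θ : ℝ) : ℂ :=
  Complex.exp ((θ / 2 : ℝ) * Complex.I)

@[fun_prop]
lemma continuous_halfDir : Continuous halfDir := by
  unfold halfDir
  fun_prop

lemma halfDir_add (α β : ℝ) : halfDir (α + β) = halfDir α * halfDir β := by
  rw [halfDir, halfDir, halfDir, ← Complex.exp_add, add_div, Complex.ofReal_add, add_mul]

lemma halfDir_add_two_pi (θ : ℝ) : halfDir (θ + 2 * π) = -halfDir θ := by
  rw [halfDir_add, halfDir, halfDir, mul_div_cancel_left₀ π two_ne_zero, Complex.exp_pi_mul_I,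
    mul_neg_one]

lemma areaForm_halfDir (α β : ℝ) : ω (halfDir α) (halfDir β) = Real.sin ((β - α) / 2) := by
  rw [Complex.areaForm, halfDir, halfDir, Complex.mul_im, Complex.conj_re, Complex.conj_im,
    Complex.exp_ofReal_mul_I_re, Complex.exp_ofReal_mul_I_im, Complex.exp_ofReal_mul_I_re,
    Complex.exp_ofReal_mul_I_im, sub_div, Real.sin_sub]
  ring

lemma areaForm_halfDir_pos {α β : ℝ} (h : α < β) (h' : β < α + 2 * π) :
    0 < ω (halfDir α) (halfDir β) := by
  rw [areaForm_halfDir]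
  exact Real.sin_pos_of_pos_of_lt_pi (by linarith) (by linarith)

lemma areaForm_halfDir_nonneg {α β : ℝ} (h : α ≤ β) (h' : β ≤ α + 2 * π) :
    0 ≤ ω (halfDir α) (halfDir β) := by
  rw [areaForm_halfDir]
  exact Real.sin_nonneg_of_nonneg_of_le_pi (by linarith) (by linarith)

lemma lt_of_areaForm_halfDir_pos {α β : ℝ} (h : α < β + 2 * π)
    (hpos : 0 < ω (halfDir α) (halfDir β)) : α < β := by
  by_contra! hle
  rw [areaForm_halfDir] at hpos
  exact hpos.not_ge (Real.sin_nonpos_of_nonpos_of_neg_pi_le (by linarith) (by linarith))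

lemma norm_smul_halfDir_two_mul_arg (z : ℂ) : ‖z‖ • halfDir (2 * z.arg) = z := by
  rw [halfDir, mul_div_cancel_left₀ _ two_ne_zero, Complex.real_smul,
    Complex.norm_mul_exp_arg_mul_I]

lemma exists_eq_norm_smul_halfDir {θ : ℝ} {z : ℂ} (hz : 0 < ω (halfDir θ) z) :
    ∃ φ ∈ Ioo θ (θ + 2 * π), z = ‖z‖ • halfDir φ := by
  set z' := halfDir (-θ) * z with hz'_def
  have hz' : z = halfDir θ * z' := by
    rw [hz'_def, ← mul_assoc, ← halfDir_add, add_neg_cancel]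
    simp [halfDir]
  have hnorm : ‖z'‖ = ‖z‖ := by
    rw [hz'_def, norm_mul, halfDir, Complex.norm_exp_ofReal_mul_I, one_mul]
  have him : 0 < z'.im := by
    convert hz using 1
    rw [Complex.areaForm, hz'_def, halfDir, halfDir, ← Complex.exp_conj]
    rw [map_mul, Complex.conj_ofReal, Complex.conj_I, neg_div, Complex.ofReal_neg, neg_mul, mul_neg]
  have harg : 0 < z'.arg ∧ z'.arg < π :=
    ⟨(Complex.arg_nonneg_iff.2 him.le).lt_of_ne' fun h ↦ him.ne' (Complex.arg_eq_zero_iff.1 h).2,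
      Complex.arg_lt_pi_iff.2 (.inr him.ne')⟩
  refine ⟨θ + 2 * z'.arg, ⟨by linarith, by linarith⟩, ?_⟩
  rw [halfDir_add, ← mul_smul_comm, ← hnorm, norm_smul_halfDir_two_mul_arg, ← hz']

end HalfDir

section FareyHeight

open unitInterval

/-- The map of the unit interval which is `s / (1 - s)`, the inverse of `s ↦ s / (1 + s)`, up to
`1 / 2` and constant from there on. -/
noncomputable def doubling : C(I, I) where
  toFun s := ⟨(s : ℝ) / max (s : ℝ) (1 - s), div_nonneg s.2.1 (s.2.1.trans (le_max_left _ _)),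
    div_le_one_of_le₀ (le_max_left _ _) (s.2.1.trans (le_max_left _ _))⟩
  continuous_toFun := by
    refine Continuous.subtype_mk (Continuous.div₀ (by fun_prop) (by fun_prop) fun s ↦ ?_) _
    have hmax := le_max_left (s : ℝ) (1 - s)
    have hmax' := le_max_right (s : ℝ) (1 - s)
    linarith

lemma coe_doubling (s : I) : (doubling s : ℝ) = s / max (s : ℝ) (1 - s) :=
  rfl

lemma doubling_eq_of_eq_div_one_add {s t : I} (h : (t : ℝ) = s / (1 + s)) : doubling t = s := by
  have hs : (0 : ℝ) < 1 + s := by linarith [s.2.1]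
  have hsub : 1 - (t : ℝ) = 1 / (1 + s) := by
    rw [h]
    field_simp
    ring
  have hle : (t : ℝ) ≤ 1 - t := by
    rw [hsub, h]
    gcongr
    exact s.2.2
  apply Subtype.ext
  rw [coe_doubling, max_eq_right hle, hsub, h, div_div_div_cancel_right₀ hs.ne', div_one]

lemma doubling_eq_one {s : I} (hs : 1 / 2 ≤ (s : ℝ)) : doubling s = 1 := by
  apply Subtype.ext
  rw [coe_doubling, max_eq_left (by linarith)]
  exact div_self (by linarith)

/-- The continuous functions on the unit interval which fix the endpoints. -/
abbrev EndpointFun : Type := {f : C(I, ℝ) // f 0 = 0 ∧ f 1 = 1}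

instance : CompleteSpace EndpointFun := by
  refine IsClosed.completeSpace_coe (hs := ?_)
  exact (isClosed_eq (by fun_prop) continuous_const).inter
    (isClosed_eq (by fun_prop) continuous_const)

instance : Nonempty EndpointFun := ⟨⟨.mk (fun s ↦ s) (by fun_prop), by simp⟩⟩

/-- The operator whose fixed points are the solutions of the functional equations
`f (s / (1 + s)) = f s / 3` and `f (1 / (2 - s)) = (2 + f s - f (1 - s)) / 3`. -/
noncomputable def fareyOperator (f : EndpointFun) : EndpointFun where
  val := ⟨fun s ↦ (f.1 (doubling s) + f.1 (σ (doubling (σ s))) + 1 - f.1 (doubling (σ s))) / 3,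
    by fun_prop⟩
  property := by
    have h0 : doubling 0 = 0 := Subtype.ext (by simp [doubling])
    have h1 : doubling 1 = 1 := doubling_eq_one (by norm_num)
    simp only [ContinuousMap.coe_mk, h0, h1, f.2.1, f.2.2, symm_zero, symm_one]
    norm_num

lemma fareyOperator_of_le_half (f : EndpointFun) {s : I} (hs : (s : ℝ) ≤ 1 / 2) :
    (fareyOperator f).1 s = f.1 (doubling s) / 3 := by
  have hσ : doubling (σ s) = 1 := doubling_eq_one (by rw [coe_symm_eq]; linarith)
  simp [fareyOperator, hσ, f.2.1, f.2.2]

lemma fareyOperator_of_half_le (f : EndpointFun) {s : I} (hs : 1 / 2 ≤ (s : ℝ)) :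
    (fareyOperator f).1 s = (2 + f.1 (σ (doubling (σ s))) - f.1 (doubling (σ s))) / 3 := by
  simp only [fareyOperator, ContinuousMap.coe_mk, doubling_eq_one hs, f.2.2]
  ring

lemma contractingWith_fareyOperator : ContractingWith (2 / 3) fareyOperator := by
  refine ⟨by rw [← NNReal.coe_lt_coe]; norm_num, LipschitzWith.of_dist_le_mul fun f g ↦ ?_⟩
  rw [Subtype.dist_eq]
  refine (ContinuousMap.dist_le (by positivity)).2 fun s ↦ ?_
  have hle (x : I) : |f.1 x - g.1 x| ≤ dist f g :=
    ContinuousMap.dist_apply_le_dist (f := f.1) (g := g.1) x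
  have hx (x : I) := abs_le.1 (hle x)
  rw [Real.dist_eq, abs_le, NNReal.coe_div, NNReal.coe_ofNat, NNReal.coe_ofNat]
  rcases le_total (s : ℝ) (1 / 2) with hs | hs
  · rw [fareyOperator_of_le_half f hs, fareyOperator_of_le_half g hs]
    constructor <;> linarith [hx (doubling s), dist_nonneg (x := f) (y := g)]
  · rw [fareyOperator_of_half_le f hs, fareyOperator_of_half_le g hs]
    constructor <;> linarith [hx (doubling (σ s)), hx (σ (doubling (σ s)))]

/-- The coordinate function of the Apollonian curve in the basis of the two initial spinors, as a
function of the projective coordinate `q / (p + q)` of the spinor `p u + q w`; the two functional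
equations which determine it correspond to the two ways of replacing a disc by a successor. -/
noncomputable def fareyHeight : ℝ → ℝ :=
  IccExtend zero_le_one contractingWith_fareyOperator.fixedPoint.1

@[fun_prop]
lemma continuous_fareyHeight : Continuous fareyHeight :=
  contractingWith_fareyOperator.fixedPoint.1.continuous.Icc_extend'

lemma fareyHeight_coe (s : I) :
    fareyHeight s = contractingWith_fareyOperator.fixedPoint.1 s :=
  IccExtend_val _ _ s

lemma fareyHeight_zero : fareyHeight 0 = 0 :=
  (fareyHeight_coe 0).trans contractingWith_fareyOperator.fixedPoint.2.1

lemma fareyHeight_one : fareyHeight 1 = 1 :=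
  (fareyHeight_coe 1).trans contractingWith_fareyOperator.fixedPoint.2.2

lemma fareyHeight_coe_eq_fareyOperator (s : I) :
    fareyHeight s = (fareyOperator contractingWith_fareyOperator.fixedPoint).1 s := by
  rw [contractingWith_fareyOperator.fixedPoint_isFixedPt, fareyHeight_coe]

lemma fareyHeight_div_one_add {s : ℝ} (hs : s ∈ Icc (0 : ℝ) 1) :
    fareyHeight (s / (1 + s)) = fareyHeight s / 3 := by
  lift s to I using hs
  have hs0 := s.2.1
  have hs1 := s.2.2
  have hpos : (0 : ℝ) < 1 + s := by linarith
  let t : I := ⟨s / (1 + s), by positivity, div_le_one_of_le₀ (by linarith) hpos.le⟩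
  have ht : (t : ℝ) ≤ 1 / 2 := by
    rw [div_le_div_iff₀ hpos two_pos]
    linarith
  rw [show (s : ℝ) / (1 + s) = t from rfl, fareyHeight_coe_eq_fareyOperator,
    fareyOperator_of_le_half _ ht, doubling_eq_of_eq_div_one_add rfl, fareyHeight_coe]

lemma fareyHeight_one_div_two_sub {s : ℝ} (hs : s ∈ Icc (0 : ℝ) 1) :
    fareyHeight (1 / (2 - s)) = (2 + fareyHeight s - fareyHeight (1 - s)) / 3 := by
  lift s to I using hs
  have hs0 := s.2.1
  have hs1 := s.2.2
  have hpos : (0 : ℝ) < 2 - s := by linarith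
  let t : I := ⟨1 / (2 - s), by positivity, div_le_one_of_le₀ (by linarith) hpos.le⟩
  have ht : 1 / 2 ≤ (t : ℝ) := one_div_le_one_div_of_le hpos (by linarith)
  have hσ : doubling (σ t) = σ s := doubling_eq_of_eq_div_one_add (by
    rw [coe_symm_eq, coe_symm_eq, show (t : ℝ) = 1 / (2 - s) from rfl]
    field_simp
    ring)
  rw [show (1 : ℝ) / (2 - s) = t from rfl, fareyHeight_coe_eq_fareyOperator,
    fareyOperator_of_half_le _ ht, hσ, symm_symm, ← coe_symm_eq, fareyHeight_coe, fareyHeight_coe]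

end FareyHeight

section FareyValue

theorem farey_neighbors_induction {P : ℕ → ℕ → ℕ → ℕ → Prop} (base : P 1 0 0 1)
    (left : ∀ p q p' q', p * q' = p' * q + 1 → P p q p' q' → P (p + q) q (p' + q') q')
    (right : ∀ p q p' q', p * q' = p' * q + 1 → P p q p' q' → P p (p + q) p' (p' + q'))
    {p q p' q' : ℕ} (hdet : p * q' = p' * q + 1) : P p q p' q' := by
  induction hn : p + q + p' + q' using Nat.strong_induction_on generalizing p q p' q' with
  | _ n ih =>
    have hp : 0 < p := Nat.pos_of_ne_zero (by rintro rfl; simp at hdet)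
    have hq' : 0 < q' := Nat.pos_of_ne_zero (by rintro rfl; simp at hdet)
    by_cases hleft : q ≤ p ∧ q' ≤ p'
    · obtain ⟨a, rfl⟩ := Nat.exists_eq_add_of_le' hleft.1
      obtain ⟨a', rfl⟩ := Nat.exists_eq_add_of_le' hleft.2
      have hdet' : a * q' = a' * q + 1 := by linarith
      exact left a q a' q' hdet' (ih _ (by lia) hdet' rfl)
    by_cases hright : p ≤ q ∧ p' ≤ q'
    · obtain ⟨b, rfl⟩ := Nat.exists_eq_add_of_le hright.1
      obtain ⟨b', rfl⟩ := Nat.exists_eq_add_of_le hright.2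
      have hdet' : p * b' = p' * b + 1 := by linarith
      exact right p b p' b' hdet' (ih _ (by lia) hdet' rfl)
    -- `(p, q)` and `(p', q')` lie strictly on either side of the diagonal.
    have hlt : q < p ∧ p' < q' := by
      by_contra! hge
      nlinarith [Nat.mul_le_mul (show p ≤ q by lia) (show q' ≤ p' by lia)]
    have hmul : (q + 1) * (p' + 1) ≤ p' * q + 1 := hdet ▸ Nat.mul_le_mul hlt.1 hlt.2
    obtain ⟨rfl, rfl⟩ : q = 0 ∧ p' = 0 := by constructor <;> nlinarith
    obtain ⟨rfl, rfl⟩ : p = 1 ∧ q' = 1 := by simpa using hdet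
    exact base

/-- The value of `fareyHeight` at the projective coordinate of the vector `p u + q w`. -/
noncomputable def fareyValue (p q : ℕ) : ℝ :=
  fareyHeight (q / (p + q))

variable {p q p' q' : ℕ}

lemma div_add_mem_Icc (p q : ℕ) : (q / (p + q) : ℝ) ∈ Icc (0 : ℝ) 1 :=
  ⟨by positivity, div_le_one_of_le₀ (le_add_of_nonneg_left p.cast_nonneg) (by positivity)⟩

lemma fareyValue_add_left (h : 0 < p + q) : fareyValue (p + q) q = fareyValue p q / 3 := by
  have hpos : (0 : ℝ) < p + q := mod_cast h
  rw [fareyValue, fareyValue, ← fareyHeight_div_one_add (div_add_mem_Icc p q), Nat.cast_add]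
  congr 1
  field_simp

lemma fareyValue_add_right (h : 0 < p + q) :
    fareyValue p (p + q) = (2 + fareyValue p q - fareyValue q p) / 3 := by
  have hpos : (0 : ℝ) < p + q := mod_cast h
  have hcompl : (p / (q + p) : ℝ) = 1 - q / (p + q) := by
    rw [eq_sub_iff_add_eq, add_comm (q : ℝ), ← add_div, div_self hpos.ne']
  rw [fareyValue, fareyValue, fareyValue, hcompl,
    ← fareyHeight_one_div_two_sub (div_add_mem_Icc p q), Nat.cast_add]
  congr 1
  have hne' : (2 - q / (p + q) : ℝ) = (p + (p + q)) / (p + q) := by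
    field_simp
    ring
  rw [hne', one_div_div]

theorem exists_fareyValue_sub_eq_mul (hdet : p * q' = p' * q + 1) :
    ∃ t : ℝ, fareyValue q p - fareyValue q' p' = t * (p + p') ∧
      fareyValue p' q' - fareyValue p q = t * (q + q') := by
  refine farey_neighbors_induction (P := fun p q p' q' ↦ ∃ t : ℝ,
    fareyValue q p - fareyValue q' p' = t * (p + p') ∧
      fareyValue p' q' - fareyValue p q = t * (q + q')) ?_ ?_ ?_ hdet
  · exact ⟨1, by simp [fareyValue, fareyHeight_zero, fareyHeight_one]⟩
  · rintro p q p' q' hdet ⟨t, h, h'⟩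
    have hpos : 0 < p + q := Nat.add_pos_left (Nat.pos_of_ne_zero (by rintro rfl; simp at hdet)) q
    have hpos' : 0 < p' + q' :=
      Nat.add_pos_right p' (Nat.pos_of_ne_zero (by rintro rfl; simp at hdet))
    rw [fareyValue_add_left hpos, fareyValue_add_left hpos', add_comm p, add_comm p',
      fareyValue_add_right (by lia), fareyValue_add_right (by lia)]
    refine ⟨t / 3, ?_, ?_⟩ <;> push_cast <;> linarith
  · rintro p q p' q' hdet ⟨t, h, h'⟩
    have hpos : 0 < p + q := Nat.add_pos_left (Nat.pos_of_ne_zero (by rintro rfl; simp at hdet)) q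
    have hpos' : 0 < p' + q' :=
      Nat.add_pos_right p' (Nat.pos_of_ne_zero (by rintro rfl; simp at hdet))
    rw [fareyValue_add_right hpos, fareyValue_add_right hpos', add_comm p, add_comm p',
      fareyValue_add_left (by lia), fareyValue_add_left (by lia)]
    refine ⟨t / 3, ?_, ?_⟩ <;> push_cast <;> linarith

end FareyValue

lemma inner_exp_exp (θ φ : ℝ) :
    ⟪Complex.exp (θ * Complex.I), Complex.exp (φ * Complex.I)⟫ = Real.cos (φ - θ) := by
  simp only [Complex.inner, Complex.mul_re, Complex.conj_re, Complex.conj_im,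
    Complex.exp_ofReal_mul_I_re, Complex.exp_ofReal_mul_I_im, Real.cos_sub]
  ring

namespace GDisc

/-- One plus the signed curvature of a generalized disc (positive for a disc, zero for a half-plane
and negative for the exterior of a circle), in units in which a reference circle of radius `a` has
curvature one. -/
noncomputable def relCurvature (a : ℝ) : GDisc → ℝ
  | ball _ r _ => 1 + a / r
  | half _ _ _ => 1
  | coball _ r _ => 1 - a / r

lemma tangent_comm {D D' : GDisc} : D.Tangent D' ↔ D'.Tangent D := by
  cases D <;> cases D' <;> simp only [Tangent]
  case ball.ball => rw [dist_comm, add_comm]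
  case half.half n t _ n' t' _ =>
    rw [eq_neg_iff_add_eq_zero, eq_neg_iff_add_eq_zero, add_comm, add_comm t]

section Tangent

variable {a r r' : ℝ} {e e' c₀ : ℂ}

lemma tangent_ball_ball_iff (hr : 0 < r) (hr' : 0 < r') (he : ‖e‖ = 1)
    (he' : ‖e'‖ = 1) :
    (ball (c₀ + (a + r) • e) r hr).Tangent (ball (c₀ + (a + r') • e') r' hr') ↔
      (1 + a / r) * (1 + a / r') * (1 - ⟪e, e'⟫) = 2 := by
  simp only [Tangent]
  rw [← sq_eq_sq₀ dist_nonneg (by positivity), dist_add_left, dist_eq_norm,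
    norm_sq_smul_sub_smul he he']
  field_simp
  constructor <;> intro h <;> linarith

lemma tangent_ball_half_iff (hr : 0 < r) (he' : ‖e'‖ = 1) :
    (ball (c₀ + (a + r) • e) r hr).Tangent (half e' (⟪e', c₀⟫ + a) he') ↔
      (1 + a / r) * (1 - ⟪e, e'⟫) = 2 := by
  simp only [Tangent]
  rw [inner_add_right, real_inner_smul_right, real_inner_comm e e']
  field_simp
  constructor <;> intro h <;> linarith

lemma tangent_ball_coball_iff (ha : 0 < a) (hr : 0 < r) (hr' : 0 < r') (har' : a < r')
    (he : ‖e‖ = 1) (he' : ‖e'‖ = 1) :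
    (ball (c₀ + (a + r) • e) r hr).Tangent (coball (c₀ + (a - r') • e') r' hr') ↔
      (1 + a / r) * (1 - a / r') * (1 - ⟪e, e'⟫) = 2 := by
  have hdist := norm_sq_smul_sub_smul he he' (a + r) (a - r')
  have hinner : -1 ≤ ⟪e, e'⟫ :=
    (abs_le.1 ((abs_real_inner_le_norm e e').trans (by simp [he, he']))).1
  simp only [Tangent]
  rw [dist_add_left, dist_eq_norm]
  field_simp
  constructor
  · rintro ⟨-, h⟩
    rw [h] at hdist
    linarith
  · intro h
    have hle : (r + a) * (r' - a) * (1 - ⟪e, e'⟫) ≤ (r + a) * (r' - a) * 2 :=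
      mul_le_mul_of_nonneg_left (by linarith)
        (mul_nonneg (by linarith) (sub_nonneg.2 har'.le))
    have hlt : r < r' := by nlinarith
    refine ⟨hlt, (sq_eq_sq₀ (norm_nonneg _) (sub_pos.2 hlt).le).1 ?_⟩
    linarith

lemma tangent_half_half_iff (ha : 0 < a) (he : ‖e‖ = 1) (he' : ‖e'‖ = 1) :
    (half e (⟪e, c₀⟫ + a) he).Tangent (half e' (⟪e', c₀⟫ + a) he') ↔ 1 - ⟪e, e'⟫ = 2 := by
  have hneg : e' = -e ↔ ⟪e, e'⟫ = -1 := by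
    rw [inner_eq_neg_one_iff_of_norm_eq_one he he', neg_eq_iff_eq_neg.symm, eq_comm]
  simp only [Tangent]
  constructor
  · rintro ⟨h, -⟩
    linarith [hneg.1 h]
  · intro h
    obtain rfl := hneg.2 (by linarith)
    refine ⟨rfl, ?_⟩
    rw [inner_neg_left]
    linarith

end Tangent

end GDisc

namespace ProperCircle

variable {C₀ : ProperCircle} {D D' : GDisc} {θ θ' : ℝ}

lemma point_eq_add_smul (C₀ : ProperCircle) (θ : ℝ) :
    C₀.point θ = C₀.center + C₀.radius • Complex.exp (θ * Complex.I) := by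
  rw [point, Complex.real_smul]

lemma touchesAt_ball_iff {c : ℂ} {r : ℝ} {hr : 0 < r} :
    C₀.TouchesAt (.ball c r hr) θ ↔
      c = C₀.center + (C₀.radius + r) • Complex.exp (θ * Complex.I) := by
  have ha := C₀.radius_pos
  rw [← sub_eq_iff_eq_add', eq_smul_iff_norm_sq_eq ha.ne' (Complex.norm_exp_ofReal_mul_I θ),
    sq_eq_sq₀ (norm_nonneg _) (by positivity), sq_eq_sq₀ (norm_nonneg _) hr.le]
  simp only [TouchesAt, disc, GDisc.Tangent, GDisc.circle, mem_ofPred_eq, point_eq_add_smul]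
  rw [dist_comm, dist_eq_norm, dist_eq_norm, sub_sub_eq_add_sub, add_comm C₀.center]

lemma touchesAt_coball_iff {c : ℂ} {r : ℝ} {hr : 0 < r} :
    C₀.TouchesAt (.coball c r hr) θ ↔
      C₀.radius < r ∧ c = C₀.center + (C₀.radius - r) • Complex.exp (θ * Complex.I) := by
  have ha := C₀.radius_pos
  simp only [TouchesAt, disc, GDisc.Tangent, GDisc.circle, mem_ofPred_eq, point_eq_add_smul]
  rw [and_assoc, and_congr_right_iff]
  intro hlt
  rw [← sub_eq_iff_eq_add', sub_eq_add_neg C₀.radius,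
    eq_smul_iff_norm_sq_eq ha.ne' (Complex.norm_exp_ofReal_mul_I θ), neg_sq,
    ← sub_eq_add_neg, ← neg_sub r, neg_sq, sq_eq_sq₀ (norm_nonneg _) (sub_pos.2 hlt).le,
    sq_eq_sq₀ (norm_nonneg _) hr.le, dist_comm, dist_eq_norm, dist_eq_norm, sub_sub_eq_add_sub,
    add_comm C₀.center]

lemma touchesAt_half_iff {n : ℂ} {t : ℝ} {hn : ‖n‖ = 1} :
    C₀.TouchesAt (.half n t hn) θ ↔
      n = Complex.exp (θ * Complex.I) ∧ t = ⟪n, C₀.center⟫ + C₀.radius := by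
  have ha := C₀.radius_pos.ne'
  simp only [TouchesAt, disc, GDisc.Tangent, GDisc.circle, mem_ofPred_eq, point_eq_add_smul]
  rw [inner_add_right, real_inner_smul_right,
    ← inner_eq_one_iff_of_norm_eq_one (𝕜 := ℝ) hn (Complex.norm_exp_ofReal_mul_I θ)]
  constructor
  · rintro ⟨h₁, h₂⟩
    exact ⟨mul_left_cancel₀ ha (by linarith), by linarith⟩
  · rintro ⟨h₁, h₂⟩
    rw [h₁]
    constructor <;> linarith

lemma TouchesAt.relCurvature_pos (h : C₀.TouchesAt D θ) : 0 < D.relCurvature C₀.radius := by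
  have ha := C₀.radius_pos
  cases D <;> simp only [GDisc.relCurvature]
  case ball => positivity
  case half => exact one_pos
  case coball c r hr => exact sub_pos.2 ((div_lt_one hr).2 (touchesAt_coball_iff.1 h).1)

lemma exists_touchesAt (C₀ : ProperCircle) (θ : ℝ) {k : ℝ} (hk : 0 < k) :
    ∃ D : GDisc, C₀.TouchesAt D θ ∧ D.relCurvature C₀.radius = k := by
  have ha := C₀.radius_pos
  rcases lt_trichotomy k 1 with h | rfl | h
  · have hk' : 0 < 1 - k := sub_pos.2 h
    refine ⟨.coball _ (C₀.radius / (1 - k)) (div_pos ha hk'), touchesAt_coball_iff.2 ⟨?_, rfl⟩, ?_⟩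
    · exact (lt_div_iff₀ hk').2 (by nlinarith)
    · rw [GDisc.relCurvature, div_div_cancel₀ ha.ne', sub_sub_cancel]
  · exact ⟨.half _ _ (Complex.norm_exp_ofReal_mul_I θ), touchesAt_half_iff.2 ⟨rfl, rfl⟩, rfl⟩
  · refine ⟨.ball _ (C₀.radius / (k - 1)) (div_pos ha (sub_pos.2 h)), touchesAt_ball_iff.2 rfl, ?_⟩
    rw [GDisc.relCurvature, div_div_cancel₀ ha.ne', add_sub_cancel]

lemma TouchesAt.relCurvature_mul_lt_two {c : ℂ} {r : ℝ} {hr : 0 < r}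
    (h : C₀.TouchesAt D θ) (h' : C₀.TouchesAt (.coball c r hr) θ')
    (hD : D.relCurvature C₀.radius ≤ 1) :
    D.relCurvature C₀.radius * (1 - C₀.radius / r) * (1 - Real.cos (θ' - θ)) < 2 := by
  have hk := h.relCurvature_pos
  have hk' : 0 < 1 - C₀.radius / r := h'.relCurvature_pos
  have hlt : 1 - C₀.radius / r < 1 := sub_lt_self _ (div_pos C₀.radius_pos hr)
  have hcos : 1 - Real.cos (θ' - θ) ≤ 2 := by linarith [Real.neg_one_le_cos (θ' - θ)]
  calc D.relCurvature C₀.radius * (1 - C₀.radius / r) * (1 - Real.cos (θ' - θ))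
      ≤ D.relCurvature C₀.radius * (1 - C₀.radius / r) * 2 := by gcongr
    _ ≤ 1 * (1 - C₀.radius / r) * 2 := by gcongr
    _ < 2 := by linarith

lemma TouchesAt.tangent_ball_iff {c : ℂ} {r : ℝ} {hr : 0 < r}
    (h : C₀.TouchesAt (.ball c r hr) θ) (h' : C₀.TouchesAt D' θ') :
    (GDisc.ball c r hr).Tangent D' ↔
      (1 + C₀.radius / r) * D'.relCurvature C₀.radius * (1 - Real.cos (θ' - θ)) = 2 := by
  have he := Complex.norm_exp_ofReal_mul_I θ
  have he' := Complex.norm_exp_ofReal_mul_I θ'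
  obtain rfl := touchesAt_ball_iff.1 h
  rw [← inner_exp_exp]
  cases D' with
  | ball c' r' hr' =>
    obtain rfl := touchesAt_ball_iff.1 h'
    exact GDisc.tangent_ball_ball_iff hr hr' he he'
  | half n' t' hn' =>
    obtain ⟨rfl, rfl⟩ := touchesAt_half_iff.1 h'
    rw [GDisc.relCurvature, mul_one]
    exact GDisc.tangent_ball_half_iff hr he'
  | coball c' r' hr' =>
    obtain ⟨hlt', rfl⟩ := touchesAt_coball_iff.1 h'
    exact GDisc.tangent_ball_coball_iff C₀.radius_pos hr hr' hlt' he he'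

lemma TouchesAt.tangent_iff (h : C₀.TouchesAt D θ) (h' : C₀.TouchesAt D' θ') :
    D.Tangent D' ↔
      D.relCurvature C₀.radius * D'.relCurvature C₀.radius * (1 - Real.cos (θ' - θ)) = 2 := by
  have ha := C₀.radius_pos
  have hswap : D.relCurvature C₀.radius * D'.relCurvature C₀.radius * (1 - Real.cos (θ' - θ)) =
      D'.relCurvature C₀.radius * D.relCurvature C₀.radius * (1 - Real.cos (θ - θ')) := by
    rw [mul_comm (D.relCurvature _), ← neg_sub θ θ', Real.cos_neg]
  match D, D' with
  | .ball c r hr, _ => exact h.tangent_ball_iff h'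
  | _, .ball c' r' hr' =>
    rw [hswap, GDisc.tangent_comm]
    exact h'.tangent_ball_iff h
  | .half n t hn, .half n' t' hn' =>
    obtain ⟨rfl, rfl⟩ := touchesAt_half_iff.1 h
    obtain ⟨rfl, rfl⟩ := touchesAt_half_iff.1 h'
    rw [GDisc.tangent_half_half_iff ha, inner_exp_exp, GDisc.relCurvature, GDisc.relCurvature,
      one_mul, one_mul]
  | .half n t hn, .coball c' r' hr' =>
    exact iff_of_false id (h.relCurvature_mul_lt_two h' le_rfl).ne
  | .coball c r hr, .half n' t' hn' =>
    rw [hswap]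
    exact iff_of_false id (h'.relCurvature_mul_lt_two h le_rfl).ne
  | .coball c r hr, .coball c' r' hr' =>
    exact iff_of_false id (h.relCurvature_mul_lt_two h' (sub_le_self _ (div_pos ha hr).le)).ne

/-- The spinor of a disc touching `C₀` at angle `θ`: the vector whose argument is half of the angle
and whose squared length is the relative curvature of the disc. -/
noncomputable def spinor (C₀ : ProperCircle) (D : GDisc) (θ : ℝ) : ℂ :=
  √(D.relCurvature C₀.radius) • halfDir θ

lemma spinor_add_two_pi : C₀.spinor D (θ + 2 * π) = -C₀.spinor D θ := by
  rw [spinor, halfDir_add_two_pi, smul_neg, spinor]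

lemma exists_spinor_eq (C₀ : ProperCircle) (θ : ℝ) {ρ : ℝ} (hρ : 0 < ρ) :
    ∃ D, C₀.TouchesAt D θ ∧ C₀.spinor D θ = ρ • halfDir θ := by
  obtain ⟨D, hD, hk⟩ := C₀.exists_touchesAt θ (pow_pos hρ 2)
  exact ⟨D, hD, by rw [spinor, hk, Real.sqrt_sq hρ.le]⟩

lemma exists_spinor_eq_of_areaForm_pos (C₀ : ProperCircle) {z : ℂ}
    (hz : 0 < ω (C₀.spinor D θ) z) :
    ∃ D', ∃ φ ∈ Ioo θ (θ + 2 * π), C₀.TouchesAt D' φ ∧ C₀.spinor D' φ = z := by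
  rw [spinor, map_smul, LinearMap.smul_apply, smul_eq_mul] at hz
  obtain ⟨φ, hφ, hzφ⟩ := exists_eq_norm_smul_halfDir (pos_of_mul_pos_right hz (Real.sqrt_nonneg _))
  have hnorm : 0 < ‖z‖ := norm_pos_iff.2 (by rintro rfl; simp at hz)
  obtain ⟨D, hD, hsp⟩ := C₀.exists_spinor_eq φ hnorm
  exact ⟨D, φ, hφ, hD, hsp.trans hzφ.symm⟩

lemma areaForm_spinor (C₀ : ProperCircle) (D D' : GDisc) (θ θ' : ℝ) :
    ω (C₀.spinor D θ) (C₀.spinor D' θ') =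
      √(D.relCurvature C₀.radius) * √(D'.relCurvature C₀.radius) * ω (halfDir θ) (halfDir θ') := by
  simp only [spinor, map_smul, LinearMap.smul_apply, smul_eq_mul]
  ring

lemma TouchesAt.areaForm_spinor_pos_iff (h : C₀.TouchesAt D θ) (h' : C₀.TouchesAt D' θ') :
    0 < ω (C₀.spinor D θ) (C₀.spinor D' θ') ↔ 0 < ω (halfDir θ) (halfDir θ') := by
  have hk := Real.sqrt_pos.2 h.relCurvature_pos
  have hk' := Real.sqrt_pos.2 h'.relCurvature_pos
  rw [areaForm_spinor, mul_pos_iff_of_pos_left (mul_pos hk hk')]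

lemma TouchesAt.halfDir_eq_smul_spinor (h : C₀.TouchesAt D θ) :
    halfDir θ = (√(D.relCurvature C₀.radius))⁻¹ • C₀.spinor D θ := by
  rw [spinor, inv_smul_smul₀ (Real.sqrt_pos.2 h.relCurvature_pos).ne']

lemma TouchesAt.tangent_iff_areaForm_sq_eq_one (h : C₀.TouchesAt D θ)
    (h' : C₀.TouchesAt D' θ') :
    D.Tangent D' ↔ ω (C₀.spinor D θ) (C₀.spinor D' θ') ^ 2 = 1 := by
  rw [h.tangent_iff h', areaForm_spinor, areaForm_halfDir, mul_pow, mul_pow,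
    Real.sq_sqrt h.relCurvature_pos.le, Real.sq_sqrt h'.relCurvature_pos.le,
    Real.sin_sq_eq_half_sub, mul_div_cancel₀ _ two_ne_zero]
  constructor <;> intro h <;> linarith

lemma TouchesAt.tangent_iff_areaForm_eq_one (h : C₀.TouchesAt D θ) (h' : C₀.TouchesAt D' θ')
    (hlt : θ < θ') (hlt' : θ' < θ + 2 * π) :
    D.Tangent D' ↔ ω (C₀.spinor D θ) (C₀.spinor D' θ') = 1 := by
  rw [h.tangent_iff_areaForm_sq_eq_one h']
  exact pow_eq_one_iff_of_nonneg
    ((h.areaForm_spinor_pos_iff h').2 (areaForm_halfDir_pos hlt hlt')).le two_ne_zero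

lemma TouchesAt.add_two_pi (h : C₀.TouchesAt D θ) : C₀.TouchesAt D (θ + 2 * π) := by
  have hpoint : C₀.point (θ + 2 * π) = C₀.point θ := by
    rw [point, point, Complex.ofReal_add, add_mul, Complex.ofReal_mul, Complex.ofReal_ofNat,
      Complex.exp_periodic]
  exact ⟨h.1, hpoint ▸ h.2⟩

end ProperCircle

/-- Two tangent discs touching `C₀` at angles `θ < θ'` less than a full turn apart: the data to
which a successor, and an Apollonian curve, is associated. -/
structure TangentPair (C₀ : ProperCircle) (D : GDisc) (θ : ℝ) (D' : GDisc) (θ' : ℝ) : Prop where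
  touches_left : C₀.TouchesAt D θ
  touches_right : C₀.TouchesAt D' θ'
  tangent : D.Tangent D'
  lt : θ < θ'
  lt_add_two_pi : θ' < θ + 2 * π

namespace TangentPair

variable {C₀ : ProperCircle} {D D' S : GDisc} {θ θ' φ : ℝ}

lemma areaForm_eq_one (h : TangentPair C₀ D θ D' θ') :
    ω (C₀.spinor D θ) (C₀.spinor D' θ') = 1 :=
  (h.touches_left.tangent_iff_areaForm_eq_one h.touches_right h.lt h.lt_add_two_pi).1 h.tangent

lemma of_areaForm_eq_one (h : C₀.TouchesAt D θ) (h' : C₀.TouchesAt D' θ')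
    (hlt : θ' < θ + 2 * π) (hlt' : θ < θ' + 2 * π)
    (hω : ω (C₀.spinor D θ) (C₀.spinor D' θ') = 1) : TangentPair C₀ D θ D' θ' := by
  have hθ : θ < θ' := lt_of_areaForm_halfDir_pos hlt'
    ((h.areaForm_spinor_pos_iff h').1 (hω ▸ one_pos))
  exact ⟨h, h', (h.tangent_iff_areaForm_eq_one h' hθ hlt).2 hω, hθ, hlt⟩

lemma of_isSuccessor_left (h : TangentPair C₀ D θ D' θ') (hS : IsSuccessor C₀ D θ D' θ' S φ) :
    TangentPair C₀ D θ S φ :=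
  ⟨h.touches_left, hS.touches, GDisc.tangent_comm.1 hS.tangent_left, hS.left_lt,
    hS.lt_right.trans h.lt_add_two_pi⟩

lemma of_isSuccessor_right (h : TangentPair C₀ D θ D' θ') (hS : IsSuccessor C₀ D θ D' θ' S φ) :
    TangentPair C₀ S φ D' θ' :=
  ⟨hS.touches, h.touches_right, hS.tangent_right, hS.lt_right,
    by linarith [h.lt_add_two_pi, hS.left_lt]⟩

lemma spinor_successor (h : TangentPair C₀ D θ D' θ') (hS : IsSuccessor C₀ D θ D' θ' S φ) :
    C₀.spinor S φ = C₀.spinor D θ + C₀.spinor D' θ' := by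
  have hcramer := areaForm_smul_eq_add (C₀.spinor D θ) (C₀.spinor D' θ') (C₀.spinor S φ)
  rwa [h.areaForm_eq_one, (h.of_isSuccessor_left hS).areaForm_eq_one,
    (h.of_isSuccessor_right hS).areaForm_eq_one, one_smul, one_smul, one_smul] at hcramer

lemma exists_successor (h : TangentPair C₀ D θ D' θ') :
    ∃ S φ, IsSuccessor C₀ D θ D' θ' S φ := by
  set u := C₀.spinor D θ
  set w := C₀.spinor D' θ'
  have hu : ω u (u + w) = 1 := by
    rw [map_add, areaForm_self_eq_zero, h.areaForm_eq_one, zero_add]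
  have hw : ω (u + w) w = 1 := by
    rw [map_add, LinearMap.add_apply, areaForm_self_eq_zero, h.areaForm_eq_one, add_zero]
  obtain ⟨S, φ, ⟨hlt, hlt'⟩, hS, hsp⟩ :=
    C₀.exists_spinor_eq_of_areaForm_pos (D := D) (θ := θ) (z := u + w) (hu ▸ one_pos)
  have hleft : TangentPair C₀ D θ S φ :=
    of_areaForm_eq_one h.touches_left hS hlt' (by linarith [Real.pi_pos]) (hsp ▸ hu)
  have hright : TangentPair C₀ S φ D' θ' :=
    of_areaForm_eq_one hS h.touches_right (by linarith [h.lt_add_two_pi]) (by linarith [h.lt])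
      (hsp ▸ hw)
  exact ⟨S, φ, hlt, hright.lt, hS, GDisc.tangent_comm.1 hleft.tangent, hright.tangent⟩

end TangentPair

section ApollonianFamily

variable {C₀ : ProperCircle} {D₁ D₂ D D' E F S : GDisc} {θ₁ θ₂ θ θ' ε ψ φ : ℝ}

lemma ApollonianFamily.trans (hE : ApollonianFamily C₀ D₁ θ₁ D₂ θ₂ E ε)
    (hF : ApollonianFamily C₀ D₁ θ₁ D₂ θ₂ F ψ) (hD : ApollonianFamily C₀ E ε F ψ D θ) :
    ApollonianFamily C₀ D₁ θ₁ D₂ θ₂ D θ := by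
  induction hD with
  | left => exact hE
  | right => exact hF
  | successor _ _ htan hS ih ih' => exact .successor ih ih' htan hS

lemma TangentPair.family_successor (h : TangentPair C₀ D₁ θ₁ D₂ θ₂)
    (hS : IsSuccessor C₀ D₁ θ₁ D₂ θ₂ S φ) : ApollonianFamily C₀ D₁ θ₁ D₂ θ₂ S φ :=
  .successor .left .right h.tangent hS

lemma ApollonianFamily.touchesAt (h : TangentPair C₀ D₁ θ₁ D₂ θ₂)
    (hD : ApollonianFamily C₀ D₁ θ₁ D₂ θ₂ D θ) : C₀.TouchesAt D θ := by
  cases hD with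
  | left => exact h.touches_left
  | right => exact h.touches_right
  | successor _ _ _ hS => exact hS.touches

lemma ApollonianFamily.mem_Icc (h : TangentPair C₀ D₁ θ₁ D₂ θ₂)
    (hD : ApollonianFamily C₀ D₁ θ₁ D₂ θ₂ D θ) : θ ∈ Icc θ₁ θ₂ := by
  induction hD with
  | left => exact left_mem_Icc.2 h.lt.le
  | right => exact right_mem_Icc.2 h.lt.le
  | successor _ _ _ hS ih ih' => exact ⟨ih.1.trans hS.left_lt.le, hS.lt_right.le.trans ih'.2⟩

lemma TangentPair.of_family (h : TangentPair C₀ D₁ θ₁ D₂ θ₂)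
    (hD : ApollonianFamily C₀ D₁ θ₁ D₂ θ₂ D θ) (hD' : ApollonianFamily C₀ D₁ θ₁ D₂ θ₂ D' θ')
    (htan : D.Tangent D') (hlt : θ < θ') : TangentPair C₀ D θ D' θ' :=
  ⟨hD.touchesAt h, hD'.touchesAt h, htan, hlt, by
    linarith [(hD.mem_Icc h).1, (hD'.mem_Icc h).2, h.lt_add_two_pi]⟩

lemma ApollonianFamily.exists_spinor_eq (h : TangentPair C₀ D₁ θ₁ D₂ θ₂)
    (hD : ApollonianFamily C₀ D₁ θ₁ D₂ θ₂ D θ) :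
    ∃ p q : ℕ, C₀.spinor D θ = p • C₀.spinor D₁ θ₁ + q • C₀.spinor D₂ θ₂ := by
  induction hD with
  | left => exact ⟨1, 0, by simp⟩
  | right => exact ⟨0, 1, by simp⟩
  | successor hD hD' htan hS ih ih' =>
    obtain ⟨p, q, hpq⟩ := ih
    obtain ⟨p', q', hpq'⟩ := ih'
    refine ⟨p + p', q + q', ?_⟩
    rw [(h.of_family hD hD' htan (hS.left_lt.trans hS.lt_right)).spinor_successor hS, hpq, hpq',
      add_smul, add_smul, add_add_add_comm]

lemma TangentPair.exists_family_smul_spinor_eq (h : TangentPair C₀ D₁ θ₁ D₂ θ₂) {p q : ℕ}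
    (hpq : 0 < p + q) :
    ∃ D θ, ApollonianFamily C₀ D₁ θ₁ D₂ θ₂ D θ ∧
      ∃ n : ℕ, 0 < n ∧ n • C₀.spinor D θ = p • C₀.spinor D₁ θ₁ + q • C₀.spinor D₂ θ₂ := by
  induction hn : p + q using Nat.strong_induction_on generalizing p q D₁ D₂ θ₁ θ₂ with
  | _ n ih =>
    rcases p.eq_zero_or_pos with rfl | hp
    · exact ⟨D₂, θ₂, .right, q, by lia, by simp⟩
    rcases q.eq_zero_or_pos with rfl | hq
    · exact ⟨D₁, θ₁, .left, p, hp, by simp⟩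
    obtain ⟨S, φ, hS⟩ := h.exists_successor
    have hsp := h.spinor_successor hS
    rcases le_total q p with hle | hle
    · obtain ⟨a, rfl⟩ := Nat.exists_eq_add_of_le hle
      obtain ⟨D, θ, hD, m, hm, hDm⟩ :=
        ih (a + q) (by lia) (h.of_isSuccessor_left hS) (p := a) (q := q) (by lia) rfl
      refine ⟨D, θ, .trans .left (h.family_successor hS) hD, m, hm, ?_⟩
      rw [hDm, hsp]
      module
    · obtain ⟨b, rfl⟩ := Nat.exists_eq_add_of_le hle
      obtain ⟨D, θ, hD, m, hm, hDm⟩ :=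
        ih (p + b) (by lia) (h.of_isSuccessor_right hS) (p := p) (q := b) (by lia) rfl
      refine ⟨D, θ, .trans (h.family_successor hS) .right hD, m, hm, ?_⟩
      rw [hDm, hsp]
      module

end ApollonianFamily

section ProjCoord

variable {u w z z' : ℂ}

/-- The projective coordinate on the lines spanned by nonnegative combinations of `u` and `w`: the
line through `p • u + q • w` has coordinate `q / (p + q)`. -/
noncomputable def projCoord (u w z : ℂ) : ℝ :=
  ω u z / (ω z w + ω u z)

lemma projCoord_smul {ρ : ℝ} (hρ : ρ ≠ 0) : projCoord u w (ρ • z) = projCoord u w z := by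
  simp only [projCoord, map_smul, LinearMap.smul_apply, smul_eq_mul, ← mul_add]
  exact mul_div_mul_left _ _ hρ

lemma projCoord_nsmul_add_nsmul (h : ω u w ≠ 0) (p q : ℕ) :
    projCoord u w (p • u + q • w) = q / (p + q) := by
  simp only [projCoord, ← Nat.cast_smul_eq_nsmul ℝ, map_add, map_smul, LinearMap.add_apply,
    LinearMap.smul_apply, areaForm_self_eq_zero, smul_eq_mul, mul_zero, add_zero, zero_add,
    ← add_mul]
  exact mul_div_mul_right _ _ h

lemma projCoord_lt_projCoord_iff (hz : 0 < ω z w + ω u z) (hz' : 0 < ω z' w + ω u z') :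
    projCoord u w z < projCoord u w z' ↔ 0 < ω u w * ω z z' := by
  rw [projCoord, projCoord, div_lt_div_iff₀ hz hz', areaForm_mul_areaForm]
  constructor <;> intro h <;> linarith

end ProjCoord

/-- The projective coordinate of `halfDir φ` with respect to the spinors of two touching discs,
which parametrizes the arc between their angles by the unit interval. -/
noncomputable def ProperCircle.arcCoord (C₀ : ProperCircle) (D₁ : GDisc) (θ₁ : ℝ) (D₂ : GDisc)
    (θ₂ φ : ℝ) : ℝ :=
  projCoord (C₀.spinor D₁ θ₁) (C₀.spinor D₂ θ₂) (halfDir φ)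

namespace TangentPair

variable {C₀ : ProperCircle} {D₁ D₂ D : GDisc} {θ₁ θ₂ θ φ φ' : ℝ}

lemma areaForm_add_areaForm_pos (h : TangentPair C₀ D₁ θ₁ D₂ θ₂) (hφ : φ ∈ Icc θ₁ θ₂) :
    0 < ω (halfDir φ) (C₀.spinor D₂ θ₂) + ω (C₀.spinor D₁ θ₁) (halfDir φ) := by
  have hk₁ := Real.sqrt_pos.2 h.touches_left.relCurvature_pos
  have hk₂ := Real.sqrt_pos.2 h.touches_right.relCurvature_pos
  have hlt := h.lt_add_two_pi
  simp only [ProperCircle.spinor, map_smul, LinearMap.smul_apply, smul_eq_mul]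
  rcases hφ.1.eq_or_lt with rfl | hφ₁
  · rw [areaForm_self_eq_zero, mul_zero, add_zero]
    exact mul_pos hk₂ (areaForm_halfDir_pos h.lt hlt)
  · exact add_pos_of_nonneg_of_pos
      (mul_nonneg hk₂.le (areaForm_halfDir_nonneg hφ.2 (by linarith)))
      (mul_pos hk₁ (areaForm_halfDir_pos hφ₁ (hφ.2.trans_lt hlt)))

lemma strictMonoOn_arcCoord (h : TangentPair C₀ D₁ θ₁ D₂ θ₂) :
    StrictMonoOn (C₀.arcCoord D₁ θ₁ D₂ θ₂) (Icc θ₁ θ₂) := by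
  intro φ hφ φ' hφ' hlt
  refine (projCoord_lt_projCoord_iff (h.areaForm_add_areaForm_pos hφ)
    (h.areaForm_add_areaForm_pos hφ')).2 ?_
  rw [h.areaForm_eq_one, one_mul]
  exact areaForm_halfDir_pos hlt (by linarith [hφ.1, hφ'.2, h.lt_add_two_pi])

lemma continuousOn_arcCoord (h : TangentPair C₀ D₁ θ₁ D₂ θ₂) :
    ContinuousOn (C₀.arcCoord D₁ θ₁ D₂ θ₂) (Icc θ₁ θ₂) := by
  have hu := (LinearMap.continuous_of_finiteDimensional (ω (C₀.spinor D₁ θ₁))).comp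
    continuous_halfDir
  have hw := (LinearMap.continuous_of_finiteDimensional (LinearMap.flip ω (C₀.spinor D₂ θ₂))).comp
    continuous_halfDir
  exact hu.continuousOn.div (hw.add hu).continuousOn fun φ hφ ↦
    (h.areaForm_add_areaForm_pos hφ).ne'

lemma arcCoord_eq_div (h : TangentPair C₀ D₁ θ₁ D₂ θ₂) (hD : C₀.TouchesAt D θ) {n p q : ℕ}
    (hn : 0 < n) (hsp : n • C₀.spinor D θ = p • C₀.spinor D₁ θ₁ + q • C₀.spinor D₂ θ₂) :
    C₀.arcCoord D₁ θ₁ D₂ θ₂ θ = q / (p + q) := by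
  have hk := (Real.sqrt_pos.2 hD.relCurvature_pos).ne'
  have hn' : (n : ℝ) ≠ 0 := mod_cast hn.ne'
  have hω : ω (C₀.spinor D₁ θ₁) (C₀.spinor D₂ θ₂) ≠ 0 := h.areaForm_eq_one ▸ one_ne_zero
  rw [ProperCircle.arcCoord, hD.halfDir_eq_smul_spinor, projCoord_smul (inv_ne_zero hk),
    ← projCoord_smul hn', Nat.cast_smul_eq_nsmul, hsp, projCoord_nsmul_add_nsmul hω]

lemma arcCoord_left (h : TangentPair C₀ D₁ θ₁ D₂ θ₂) : C₀.arcCoord D₁ θ₁ D₂ θ₂ θ₁ = 0 := by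
  rw [h.arcCoord_eq_div h.touches_left (n := 1) (p := 1) (q := 0) one_pos (by simp)]
  simp

lemma arcCoord_right (h : TangentPair C₀ D₁ θ₁ D₂ θ₂) : C₀.arcCoord D₁ θ₁ D₂ θ₂ θ₂ = 1 := by
  rw [h.arcCoord_eq_div h.touches_right (n := 1) (p := 0) (q := 1) one_pos (by simp)]
  simp

lemma image_arcCoord (h : TangentPair C₀ D₁ θ₁ D₂ θ₂) :
    C₀.arcCoord D₁ θ₁ D₂ θ₂ '' Icc θ₁ θ₂ = Icc 0 1 := by
  rw [h.continuousOn_arcCoord.image_Icc_of_monotoneOn h.lt.le h.strictMonoOn_arcCoord.monotoneOn,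
    h.arcCoord_left, h.arcCoord_right]

lemma exists_arcCoord_eq_rat (h : TangentPair C₀ D₁ θ₁ D₂ θ₂) {r : ℚ}
    (hr : (r : ℝ) ∈ Icc (0 : ℝ) 1) :
    ∃ D θ, ApollonianFamily C₀ D₁ θ₁ D₂ θ₂ D θ ∧ C₀.arcCoord D₁ θ₁ D₂ θ₂ θ = r := by
  have hr₀ : 0 ≤ r := mod_cast hr.1
  have hr₁ : r ≤ 1 := mod_cast hr.2
  lift r to ℚ≥0 using hr₀
  have hle : r.num ≤ r.den := by
    rw [← Nat.cast_le (α := ℚ≥0), ← div_le_one₀ (mod_cast r.den_pos), NNRat.num_div_den]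
    exact_mod_cast hr₁
  obtain ⟨a, ha⟩ := Nat.exists_eq_add_of_le' hle
  obtain ⟨D, θ, hD, n, hn, hsp⟩ := h.exists_family_smul_spinor_eq (p := a) (q := r.num)
    (ha ▸ r.den_pos)
  refine ⟨D, θ, hD, ?_⟩
  rw [h.arcCoord_eq_div (hD.touchesAt h) hn hsp, ← Nat.cast_add, ← ha, ← NNRat.cast_def,
    Rat.cast_nnratCast]

lemma exists_family_between (h : TangentPair C₀ D₁ θ₁ D₂ θ₂) (hφ : φ ∈ Icc θ₁ θ₂)
    (hφ' : φ' ∈ Icc θ₁ θ₂) (hlt : φ < φ') :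
    ∃ D, ∃ θ ∈ Ioo φ φ', ApollonianFamily C₀ D₁ θ₁ D₂ θ₂ D θ := by
  obtain ⟨r, hr, hr'⟩ := exists_rat_btwn (h.strictMonoOn_arcCoord hφ hφ' hlt)
  have hc := h.image_arcCoord.le (mem_image_of_mem _ hφ)
  have hc' := h.image_arcCoord.le (mem_image_of_mem _ hφ')
  obtain ⟨D, θ, hD, hθ⟩ :=
    h.exists_arcCoord_eq_rat ⟨hc.1.trans hr.le, hr'.le.trans hc'.2⟩
  rw [← hθ] at hr hr'
  have hmem := hD.mem_Icc h
  exact ⟨D, θ, ⟨(h.strictMonoOn_arcCoord.lt_iff_lt hφ hmem).1 hr,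
    (h.strictMonoOn_arcCoord.lt_iff_lt hmem hφ').1 hr'⟩, hD⟩

theorem dense_family (h : TangentPair C₀ D₁ θ₁ D₂ θ₂) :
    Dense {φ : Icc θ₁ θ₂ | ∃ D, ApollonianFamily C₀ D₁ θ₁ D₂ θ₂ D φ} := by
  have : Nontrivial (Icc θ₁ θ₂) := ⟨⟨⟨θ₁, left_mem_Icc.2 h.lt.le⟩, ⟨θ₂, right_mem_Icc.2 h.lt.le⟩,
    fun heq ↦ h.lt.ne (congrArg Subtype.val heq)⟩⟩
  refine dense_of_exists_between fun φ φ' hlt ↦ ?_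
  obtain ⟨D, θ, hθ, hD⟩ := h.exists_family_between φ.2 φ'.2 hlt
  exact ⟨⟨θ, hD.mem_Icc h⟩, ⟨D, hD⟩, hθ.1, hθ.2⟩

lemma eqOn_of_family {X : Type*} [TopologicalSpace X] [T2Space X] {f g : ℝ → X}
    (h : TangentPair C₀ D₁ θ₁ D₂ θ₂) (hf : ContinuousOn f (Icc θ₁ θ₂))
    (hg : ContinuousOn g (Icc θ₁ θ₂))
    (hfg : ∀ D θ, ApollonianFamily C₀ D₁ θ₁ D₂ θ₂ D θ → f θ = g θ) : EqOn f g (Icc θ₁ θ₂) := by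
  rw [← domRestrict_eq_domRestrict_iff]
  exact hf.domRestrict.ext_on h.dense_family hg.domRestrict fun φ ⟨D, hD⟩ ↦ hfg D φ hD

end TangentPair

section ApollonianCurve

variable {C₀ : ProperCircle} {D₁ D₂ D : GDisc} {θ₁ θ₂ θ : ℝ} {γ γ' : ℝ → ℂ}

theorem TangentPair.isApollonianCurve_iff (h : TangentPair C₀ D₁ θ₁ D₂ θ₂) :
    IsApollonianCurve C₀ D₁ θ₁ D₂ θ₂ γ ↔ ContinuousOn γ (Icc θ₁ θ₂) ∧
      ∀ D θ D' θ', ApollonianFamily C₀ D₁ θ₁ D₂ θ₂ D θ → ApollonianFamily C₀ D₁ θ₁ D₂ θ₂ D' θ' →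
        TangentPair C₀ D θ D' θ' →
          ∃ t : ℝ, γ θ' - γ θ = t • (C₀.spinor D θ + C₀.spinor D' θ') := by
  refine and_congr_right fun _ ↦ ⟨fun hγ D θ D' θ' hD hD' hpair ↦ ?_,
    fun hγ D θ D' θ' S φ hD hD' htan hS ↦ ?_⟩
  · obtain ⟨S, φ, hS⟩ := hpair.exists_successor
    obtain ⟨t, ht⟩ := hγ D θ D' θ' S φ hD hD' hpair.tangent hS
    refine ⟨-(t * (√(S.relCurvature C₀.radius))⁻¹), ?_⟩
    rw [← Complex.real_smul, ← halfDir, hS.touches.halfDir_eq_smul_spinor,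
      hpair.spinor_successor hS, smul_smul] at ht
    rw [neg_smul, ← ht, neg_sub]
  · have hpair := h.of_family hD hD' htan (hS.left_lt.trans hS.lt_right)
    obtain ⟨t, ht⟩ := hγ D θ D' θ' hD hD' hpair
    refine ⟨-(t * √(S.relCurvature C₀.radius)), ?_⟩
    rw [← neg_sub, ht, ← hpair.spinor_successor hS, ← Complex.real_smul, ← halfDir,
      ProperCircle.spinor, smul_smul, neg_smul]

lemma eq_zero_of_eq_smul_of_eq_smul {u w z : ℂ} (h : ω u w ≠ 0) {a b : ℝ} (hu : z = a • u)
    (hw : z = b • w) : z = 0 := by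
  have hcramer := areaForm_smul_eq_add u w z
  have huz : ω u z = 0 := by rw [hu, map_smul, areaForm_self_eq_zero, smul_zero]
  have hzw : ω z w = 0 := by
    rw [hw, map_smul, LinearMap.smul_apply, areaForm_self_eq_zero, smul_zero]
  rw [huz, hzw, zero_smul, zero_smul, add_zero] at hcramer
  exact (smul_eq_zero.1 hcramer).resolve_left h

theorem IsApollonianCurve.eqOn (hγ : IsApollonianCurve C₀ D₁ θ₁ D₂ θ₂ γ)
    (hγ' : IsApollonianCurve C₀ D₁ θ₁ D₂ θ₂ γ') (h : TangentPair C₀ D₁ θ₁ D₂ θ₂)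
    (h₁ : γ θ₁ = γ' θ₁) (h₂ : γ θ₂ = γ' θ₂) : EqOn γ γ' (Icc θ₁ θ₂) := by
  obtain ⟨hcont, hchord⟩ := h.isApollonianCurve_iff.1 hγ
  obtain ⟨hcont', hchord'⟩ := h.isApollonianCurve_iff.1 hγ'
  refine h.eqOn_of_family hcont hcont' fun D θ hD ↦ ?_
  induction hD with
  | left => exact h₁
  | right => exact h₂
  | @successor E ε F ψ S φ hE hF htan hS ihE ihF =>
    have hEF := h.of_family hE hF htan (hS.left_lt.trans hS.lt_right)
    have hES := hEF.of_isSuccessor_left hS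
    have hSF := hEF.of_isSuccessor_right hS
    have hSfam : ApollonianFamily C₀ D₁ θ₁ D₂ θ₂ S φ := .successor hE hF htan hS
    obtain ⟨a, ha⟩ := hchord _ _ _ _ hE hSfam hES
    obtain ⟨a', ha'⟩ := hchord' _ _ _ _ hE hSfam hES
    obtain ⟨b, hb⟩ := hchord _ _ _ _ hSfam hF hSF
    obtain ⟨b', hb'⟩ := hchord' _ _ _ _ hSfam hF hSF
    have hω : ω (C₀.spinor E ε + C₀.spinor S φ) (C₀.spinor S φ + C₀.spinor F ψ) = 3 := by
      simp only [map_add, LinearMap.add_apply, areaForm_self_eq_zero, hES.areaForm_eq_one,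
        hSF.areaForm_eq_one, hEF.areaForm_eq_one]
      norm_num
    refine sub_eq_zero.1 (eq_zero_of_eq_smul_of_eq_smul (hω ▸ three_ne_zero)
      (a := a - a') (b := b' - b) ?_ ?_)
    · rw [sub_smul, ← ha, ← ha', ihE]
      abel
    · rw [sub_smul, ← hb, ← hb', ihF]
      abel

end ApollonianCurve

section ApollonianArc

variable {C₀ : ProperCircle} {D₁ D₂ : GDisc} {θ₁ θ₂ t : ℝ} {γ : ℝ → ℂ} {g a b u w : ℂ}

/-- The universal Apollonian curve from `a` to `b` with control point `g`, parametrized by the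
projective coordinate on the unit interval. -/
noncomputable def apollonianArc (g a b : ℂ) (s : ℝ) : ℂ :=
  g + fareyHeight (1 - s) • (a - g) + fareyHeight s • (b - g)

@[fun_prop]
lemma continuous_apollonianArc : Continuous (apollonianArc g a b) := by
  unfold apollonianArc
  fun_prop

lemma apollonianArc_zero : apollonianArc g a b 0 = a := by
  simp [apollonianArc, fareyHeight_zero, fareyHeight_one]

lemma apollonianArc_one : apollonianArc g a b 1 = b := by
  simp [apollonianArc, fareyHeight_zero, fareyHeight_one]

lemma apollonianArc_one_sub (s : ℝ) : apollonianArc g a b (1 - s) = apollonianArc g b a s := by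
  rw [apollonianArc, apollonianArc, sub_sub_cancel, add_right_comm]

lemma image_apollonianArc_comm (g a b : ℂ) :
    apollonianArc g a b '' Icc 0 1 = apollonianArc g b a '' Icc 0 1 := by
  rw [← funext (apollonianArc_one_sub (g := g) (a := a) (b := b)),
    ← image_image (apollonianArc g a b) (1 - ·), image_const_sub_Icc, sub_zero, sub_self]

lemma apollonianArc_div {p q : ℕ} (h : 0 < p + q) :
    apollonianArc g a b (q / (p + q)) =
      g + fareyValue q p • (a - g) + fareyValue p q • (b - g) := by
  have hpos : (0 : ℝ) < p + q := mod_cast h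
  have hcompl : (1 - q / (p + q) : ℝ) = p / (q + p) := by
    rw [add_comm (q : ℝ), sub_eq_iff_eq_add, ← add_div, div_self hpos.ne']
  rw [apollonianArc, hcompl, fareyValue, fareyValue]

lemma exists_apollonianArc_sub_eq_smul (ha : g - a = t • u) (hb : b - g = t • w) {p q p' q' : ℕ}
    (hdet : p * q' = p' * q + 1) :
    ∃ s : ℝ, apollonianArc g a b (q' / (p' + q')) - apollonianArc g a b (q / (p + q)) =
      s • ((p • u + q • w) + (p' • u + q' • w)) := by
  have hp : 0 < p := Nat.pos_of_ne_zero (by rintro rfl; simp at hdet)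
  have hq' : 0 < q' := Nat.pos_of_ne_zero (by rintro rfl; simp at hdet)
  obtain ⟨s, hs, hs'⟩ := exists_fareyValue_sub_eq_mul hdet
  refine ⟨s * t, ?_⟩
  rw [apollonianArc_div (by lia), apollonianArc_div (by lia), ← neg_sub g a, ha, hb]
  linear_combination (norm := module) hs • t • u + hs' • t • w

theorem TangentPair.isApollonianCurve_apollonianArc (h : TangentPair C₀ D₁ θ₁ D₂ θ₂)
    (ha : g - a = t • C₀.spinor D₁ θ₁) (hb : b - g = t • C₀.spinor D₂ θ₂) :
    IsApollonianCurve C₀ D₁ θ₁ D₂ θ₂ (apollonianArc g a b ∘ C₀.arcCoord D₁ θ₁ D₂ θ₂) := by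
  refine h.isApollonianCurve_iff.2
    ⟨continuous_apollonianArc.comp_continuousOn h.continuousOn_arcCoord, ?_⟩
  intro D θ D' θ' hD hD' hpair
  obtain ⟨p, q, hpq⟩ := hD.exists_spinor_eq h
  obtain ⟨p', q', hpq'⟩ := hD'.exists_spinor_eq h
  have hdet : p * q' = p' * q + 1 := by
    have hωwu : ω (C₀.spinor D₂ θ₂) (C₀.spinor D₁ θ₁) = -1 := by
      rw [Complex.orientation.areaForm_swap, h.areaForm_eq_one]
    have hω := hpair.areaForm_eq_one
    rw [hpq, hpq'] at hω
    simp only [← Nat.cast_smul_eq_nsmul ℝ, map_add, map_smul, LinearMap.add_apply,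
      LinearMap.smul_apply, areaForm_self_eq_zero, smul_eq_mul, h.areaForm_eq_one,
      hωwu] at hω
    have hreal : (p * q' : ℝ) = p' * q + 1 := by linarith
    exact_mod_cast hreal
  rw [Function.comp_apply, Function.comp_apply,
    h.arcCoord_eq_div (hD.touchesAt h) one_pos ((one_smul ℕ _).trans hpq),
    h.arcCoord_eq_div (hD'.touchesAt h) one_pos ((one_smul ℕ _).trans hpq'), hpq, hpq']
  exact exists_apollonianArc_sub_eq_smul ha hb hdet

lemma TangentPair.exists_isApollonianCurve (h : TangentPair C₀ D₁ θ₁ D₂ θ₂)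
    (ha : g - a = t • C₀.spinor D₁ θ₁) (hb : b - g = t • C₀.spinor D₂ θ₂) :
    ∃ γ, IsApollonianCurve C₀ D₁ θ₁ D₂ θ₂ γ ∧ γ θ₁ = a ∧ γ θ₂ = b ∧
      γ '' Icc θ₁ θ₂ = apollonianArc g a b '' Icc 0 1 := by
  refine ⟨_, h.isApollonianCurve_apollonianArc ha hb, ?_, ?_, ?_⟩
  · rw [Function.comp_apply, h.arcCoord_left, apollonianArc_zero]
  · rw [Function.comp_apply, h.arcCoord_right, apollonianArc_one]
  · rw [image_comp, h.image_arcCoord]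

theorem IsApollonianCurve.image_eq (hγ : IsApollonianCurve C₀ D₁ θ₁ D₂ θ₂ γ)
    (h : TangentPair C₀ D₁ θ₁ D₂ θ₂) (ha : g - γ θ₁ = t • C₀.spinor D₁ θ₁)
    (hb : γ θ₂ - g = t • C₀.spinor D₂ θ₂) :
    γ '' Icc θ₁ θ₂ = apollonianArc g (γ θ₁) (γ θ₂) '' Icc 0 1 := by
  obtain ⟨γ', hγ', h₁, h₂, himage⟩ := h.exists_isApollonianCurve ha hb
  rw [(hγ.eqOn hγ' h h₁.symm h₂.symm).image_eq, himage]

lemma IsApollonianCurve.exists_sub_eq_smul (hγ : IsApollonianCurve C₀ D₁ θ₁ D₂ θ₂ γ)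
    (h : TangentPair C₀ D₁ θ₁ D₂ θ₂) :
    ∃ t : ℝ, γ θ₂ - γ θ₁ = t • (C₀.spinor D₁ θ₁ + C₀.spinor D₂ θ₂) :=
  (h.isApollonianCurve_iff.1 hγ).2 _ _ _ _ .left .right h

end ApollonianArc

/-- Three pairwise tangent discs touching `C₀` in counterclockwise order; the third pair closes up
after a full turn. -/
structure TangentTriple (C₀ : ProperCircle) (D₁ D₂ D₃ : GDisc) (θ₁ θ₂ θ₃ : ℝ) : Prop where
  pair₁₂ : TangentPair C₀ D₁ θ₁ D₂ θ₂
  pair₂₃ : TangentPair C₀ D₂ θ₂ D₃ θ₃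
  pair₃₁ : TangentPair C₀ D₃ θ₃ D₁ (θ₁ + 2 * π)

section Triangle

variable {C₀ : ProperCircle} {D₁ D₂ D₃ : GDisc} {θ₁ θ₂ θ₃ t : ℝ} {γ₁₂ γ₂₃ γ₃₁ : ℝ → ℂ}
  {a b c g u w : ℂ}

lemma TangentTriple.spinor_third (h : TangentTriple C₀ D₁ D₂ D₃ θ₁ θ₂ θ₃) :
    C₀.spinor D₃ θ₃ = C₀.spinor D₂ θ₂ - C₀.spinor D₁ θ₁ := by
  have hcramer := areaForm_smul_eq_add (C₀.spinor D₁ θ₁) (C₀.spinor D₂ θ₂) (C₀.spinor D₃ θ₃)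
  have h₃₁ := h.pair₃₁.areaForm_eq_one
  rw [ProperCircle.spinor_add_two_pi, map_neg, ← Complex.orientation.areaForm_swap] at h₃₁
  rw [h.pair₁₂.areaForm_eq_one, Complex.orientation.areaForm_swap, h.pair₂₃.areaForm_eq_one, h₃₁,
    one_smul, neg_one_smul, one_smul] at hcramer
  rw [hcramer, neg_add_eq_sub]

theorem exists_tangentTriple (C₀ : ProperCircle) (h : ω u w = 1) :
    ∃ D₁ D₂ D₃ θ₁ θ₂ θ₃, TangentTriple C₀ D₁ D₂ D₃ θ₁ θ₂ θ₃ ∧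
      C₀.spinor D₁ θ₁ = u ∧ C₀.spinor D₂ θ₂ = w := by
  have hu : u ≠ 0 := by
    rintro rfl
    simp at h
  have hwu : ω w u = -1 := by rw [Complex.orientation.areaForm_swap, h]
  have huw : ω u (w - u) = 1 := by rw [map_sub, areaForm_self_eq_zero, sub_zero, h]
  obtain ⟨D₁, hD₁, hsp₁⟩ := C₀.exists_spinor_eq (2 * u.arg) (norm_pos_iff.2 hu)
  rw [norm_smul_halfDir_two_mul_arg] at hsp₁
  obtain ⟨D₂, θ₂, hθ₂, hD₂, hsp₂⟩ :=
    C₀.exists_spinor_eq_of_areaForm_pos (z := w) (by rw [hsp₁, h]; exact one_pos)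
  obtain ⟨D₃, θ₃, hθ₃, hD₃, hsp₃⟩ :=
    C₀.exists_spinor_eq_of_areaForm_pos (z := w - u) (by rw [hsp₁, huw]; exact one_pos)
  refine ⟨D₁, D₂, D₃, _, θ₂, θ₃, ⟨?_, ?_, ?_⟩, hsp₁, hsp₂⟩
  · exact .of_areaForm_eq_one hD₁ hD₂ hθ₂.2 (by linarith [hθ₂.1, Real.pi_pos])
      (by rw [hsp₁, hsp₂, h])
  · exact .of_areaForm_eq_one hD₂ hD₃ (by linarith [hθ₂.1, hθ₃.2]) (by linarith [hθ₂.2, hθ₃.1])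
      (by rw [hsp₂, hsp₃, map_sub, areaForm_self_eq_zero, hwu, zero_sub, neg_neg])
  · refine .of_areaForm_eq_one hD₃ hD₁.add_two_pi (by linarith [hθ₃.1])
      (by linarith [hθ₃.2, Real.pi_pos]) ?_
    rw [ProperCircle.spinor_add_two_pi, hsp₁, hsp₃, map_neg, map_sub, LinearMap.sub_apply,
      areaForm_self_eq_zero, hwu, sub_zero, neg_neg]

lemma IsApollonianConfiguration.tangentTriple
    (hC : IsApollonianConfiguration C₀ D₁ D₂ D₃ θ₁ θ₂ θ₃ γ₁₂ γ₂₃ γ₃₁) :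
    TangentTriple C₀ D₁ D₂ D₃ θ₁ θ₂ θ₃ where
  pair₁₂ := ⟨hC.touches₁, hC.touches₂, hC.tangent₁₂, hC.lt₁₂, hC.lt₂₃.trans hC.lt₃₁⟩
  pair₂₃ := ⟨hC.touches₂, hC.touches₃, hC.tangent₂₃, hC.lt₂₃, by linarith [hC.lt₁₂, hC.lt₃₁]⟩
  pair₃₁ := ⟨hC.touches₃, hC.touches₁.add_two_pi, hC.tangent₃₁, hC.lt₃₁, by
    linarith [hC.lt₁₂, hC.lt₂₃]⟩

lemma TangentTriple.sub_eq_smul (h : TangentTriple C₀ D₁ D₂ D₃ θ₁ θ₂ θ₃)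
    (hg : a + b + c = (3 : ℝ) • g) (ha : g - a = t • C₀.spinor D₁ θ₁)
    (hb : b - g = t • C₀.spinor D₂ θ₂) :
    (g - b = (-t) • C₀.spinor D₂ θ₂ ∧ c - g = (-t) • C₀.spinor D₃ θ₃) ∧
      g - c = t • C₀.spinor D₃ θ₃ ∧ a - g = t • C₀.spinor D₁ (θ₁ + 2 * π) := by
  have hc : g - c = t • C₀.spinor D₃ θ₃ := by
    rw [h.spinor_third]
    linear_combination (norm := module) hb - ha - hg
  exact ⟨⟨by rw [neg_smul, ← hb, neg_sub], by rw [neg_smul, ← hc, neg_sub]⟩, hc, by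
    rw [ProperCircle.spinor_add_two_pi, smul_neg, ← ha, neg_sub]⟩

theorem TangentTriple.exists_isApollonianConfiguration
    (h : TangentTriple C₀ D₁ D₂ D₃ θ₁ θ₂ θ₃) (hg : a + b + c = (3 : ℝ) • g)
    (ha : g - a = t • C₀.spinor D₁ θ₁) (hb : b - g = t • C₀.spinor D₂ θ₂) :
    ∃ γ₁₂ γ₂₃ γ₃₁, IsApollonianConfiguration C₀ D₁ D₂ D₃ θ₁ θ₂ θ₃ γ₁₂ γ₂₃ γ₃₁ ∧
      γ₁₂ θ₁ = a ∧ γ₂₃ θ₂ = b ∧ γ₃₁ θ₃ = c := by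
  obtain ⟨⟨hb', hc⟩, hc', ha'⟩ := h.sub_eq_smul hg ha hb
  obtain ⟨γ₁₂, h₁₂, h₁₂a, h₁₂b, -⟩ := h.pair₁₂.exists_isApollonianCurve ha hb
  obtain ⟨γ₂₃, h₂₃, h₂₃b, h₂₃c, -⟩ := h.pair₂₃.exists_isApollonianCurve hb' hc
  obtain ⟨γ₃₁, h₃₁, h₃₁c, h₃₁a, -⟩ := h.pair₃₁.exists_isApollonianCurve hc' ha'
  exact ⟨γ₁₂, γ₂₃, γ₃₁, ⟨h.pair₁₂.touches_left, h.pair₂₃.touches_left, h.pair₃₁.touches_left,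
    h.pair₁₂.tangent, h.pair₂₃.tangent, h.pair₃₁.tangent, h.pair₁₂.lt, h.pair₂₃.lt, h.pair₃₁.lt,
    h₁₂, h₂₃, h₃₁, h₁₂b.trans h₂₃b.symm, h₂₃c.trans h₃₁c.symm, h₃₁a.trans h₁₂a.symm⟩,
    h₁₂a, h₂₃b, h₃₁c⟩

lemma sub_eq_smul_of_closed_triangle {t₁ t₂ t₃ : ℝ} (h : ω u w ≠ 0)
    (hab : b - a = t₁ • (u + w)) (hbc : c - b = t₂ • (w + (w - u)))
    (hca : a - c = t₃ • ((w - u) + -u)) (hg : a + b + c = (3 : ℝ) • g) :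
    g - a = t₁ • u ∧ b - g = t₁ • w := by
  have hclosed : (t₁ - t₂ - 2 * t₃) • u = (-(t₁ + 2 * t₂ + t₃)) • w := by
    linear_combination (norm := module) -(hab + hbc + hca)
  have h₁ : t₁ - t₂ - 2 * t₃ = 0 := by
    have hω := congrArg (ω · w) hclosed
    simp only [map_smul, LinearMap.smul_apply, areaForm_self_eq_zero, smul_zero] at hω
    exact (smul_eq_zero.1 hω).resolve_right h
  have h₂ : -(t₁ + 2 * t₂ + t₃) = 0 := by
    have hω := congrArg (ω u) hclosed
    simp only [map_smul, areaForm_self_eq_zero, smul_zero] at hω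
    exact (smul_eq_zero.1 hω.symm).resolve_right h
  obtain rfl : t₂ = -t₁ := by linarith
  obtain rfl : t₃ = t₁ := by linarith
  constructor
  · linear_combination (norm := module) (1 / 3 : ℝ) • (hab - hca - hg)
  · linear_combination (norm := module) (1 / 3 : ℝ) • (hab - hbc + hg)

theorem IsApollonianConfiguration.exists_sub_eq_smul
    (hC : IsApollonianConfiguration C₀ D₁ D₂ D₃ θ₁ θ₂ θ₃ γ₁₂ γ₂₃ γ₃₁)
    (hg : γ₁₂ θ₁ + γ₂₃ θ₂ + γ₃₁ θ₃ = (3 : ℝ) • g) :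
    ∃ t : ℝ, g - γ₁₂ θ₁ = t • C₀.spinor D₁ θ₁ ∧ γ₂₃ θ₂ - g = t • C₀.spinor D₂ θ₂ := by
  have h := hC.tangentTriple
  obtain ⟨t₁, h₁⟩ := hC.curve₁₂.exists_sub_eq_smul h.pair₁₂
  obtain ⟨t₂, h₂⟩ := hC.curve₂₃.exists_sub_eq_smul h.pair₂₃
  obtain ⟨t₃, h₃⟩ := hC.curve₃₁.exists_sub_eq_smul h.pair₃₁
  rw [hC.vertex₂] at h₁
  rw [hC.vertex₃, h.spinor_third] at h₂
  rw [hC.vertex₁, h.spinor_third, ProperCircle.spinor_add_two_pi] at h₃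
  exact ⟨t₁, sub_eq_smul_of_closed_triangle (h.pair₁₂.areaForm_eq_one ▸ one_ne_zero) h₁ h₂ h₃ hg⟩

theorem IsApollonianConfiguration.image_union_eq
    (hC : IsApollonianConfiguration C₀ D₁ D₂ D₃ θ₁ θ₂ θ₃ γ₁₂ γ₂₃ γ₃₁)
    (hg : γ₁₂ θ₁ + γ₂₃ θ₂ + γ₃₁ θ₃ = (3 : ℝ) • g) :
    γ₁₂ '' Icc θ₁ θ₂ ∪ γ₂₃ '' Icc θ₂ θ₃ ∪ γ₃₁ '' Icc θ₃ (θ₁ + 2 * π) =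
      apollonianArc g (γ₁₂ θ₁) (γ₂₃ θ₂) '' Icc 0 1 ∪ apollonianArc g (γ₂₃ θ₂) (γ₃₁ θ₃) '' Icc 0 1 ∪
        apollonianArc g (γ₃₁ θ₃) (γ₁₂ θ₁) '' Icc 0 1 := by
  have h := hC.tangentTriple
  obtain ⟨t, ha, hb⟩ := hC.exists_sub_eq_smul hg
  obtain ⟨⟨hb', hc⟩, hc', ha'⟩ := h.sub_eq_smul hg ha hb
  rw [hC.curve₁₂.image_eq h.pair₁₂ ha (hC.vertex₂ ▸ hb),
    hC.curve₂₃.image_eq h.pair₂₃ hb' (hC.vertex₃ ▸ hc),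
    hC.curve₃₁.image_eq h.pair₃₁ hc' (hC.vertex₁ ▸ ha'), hC.vertex₁, hC.vertex₂, hC.vertex₃]

end Triangle

section ApollonianTriangle

/-- The boundary of the Apollonian triangle with vertex set `V`: the arcs between any two vertices,
all of them with the centroid of `V` as control point. -/
noncomputable def apollonianBoundary (V : Finset ℂ) : Set ℂ :=
  ⋃ e ∈ V.offDiag, apollonianArc ((V.card : ℝ)⁻¹ • ∑ v ∈ V, v) e.1 e.2 '' Icc 0 1

variable {a b c g : ℂ} {T : Set ℂ}

lemma apollonianBoundary_eq (hab : a ≠ b) (hac : a ≠ c) (hbc : b ≠ c)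
    (hg : a + b + c = (3 : ℝ) • g) :
    apollonianBoundary {a, b, c} = apollonianArc g a b '' Icc 0 1 ∪ apollonianArc g b c '' Icc 0 1 ∪
      apollonianArc g c a '' Icc 0 1 := by
  have hcard : ({a, b, c} : Finset ℂ).card = 3 :=
    Finset.card_triple_eq_three_iff.2 ⟨hab, hac, hbc⟩
  have hcentroid : (({a, b, c} : Finset ℂ).card : ℝ)⁻¹ • ∑ v ∈ {a, b, c}, v = g := by
    rw [hcard, Finset.sum_insert (by simp [hab, hac]), Finset.sum_pair hbc, ← add_assoc, hg,
      Nat.cast_ofNat, inv_smul_smul₀ three_ne_zero]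
  have hoffDiag : ({a, b, c} : Finset ℂ).offDiag =
      {(a, b), (b, a), (b, c), (c, b), (c, a), (a, c)} := by
    ext ⟨x, y⟩
    simp only [Finset.mem_offDiag, Finset.mem_insert, Finset.mem_singleton, Prod.mk.injEq]
    grind
  rw [apollonianBoundary, hcentroid, hoffDiag]
  simp only [Finset.mem_insert, Finset.mem_singleton, iUnion_iUnion_eq_or_left,
    iUnion_iUnion_eq_left, image_apollonianArc_comm g b a, image_apollonianArc_comm g c b,
    image_apollonianArc_comm g a c]
  grind

theorem IsApollonianTriangle.eq_enclosedRegion {V : Finset ℂ} (hV : V.card = 3)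
    (hT : IsApollonianTriangle T V) : T = enclosedRegion (apollonianBoundary V) := by
  obtain ⟨C₀, D₁, D₂, D₃, θ₁, θ₂, θ₃, γ₁₂, γ₂₃, γ₃₁, hC, hvert, rfl⟩ := hT
  obtain rfl : V = {γ₁₂ θ₁, γ₂₃ θ₂, γ₃₁ θ₃} := by
    rw [← Finset.coe_inj, hvert]
    push_cast
    rfl
  obtain ⟨hab, hac, hbc⟩ := Finset.card_triple_eq_three_iff.1 hV
  have hg : γ₁₂ θ₁ + γ₂₃ θ₂ + γ₃₁ θ₃ =
      (3 : ℝ) • (3 : ℝ)⁻¹ • (γ₁₂ θ₁ + γ₂₃ θ₂ + γ₃₁ θ₃) := (smul_inv_smul₀ three_ne_zero _).symm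
  rw [hC.image_union_eq hg, apollonianBoundary_eq hab hac hbc hg]

theorem exists_isApollonianTriangle_of_areaForm_neg (h : ω (b - a) (c - a) < 0) :
    ∃ T, IsApollonianTriangle T {a, b, c} := by
  set g : ℂ := (3 : ℝ)⁻¹ • (a + b + c)
  have hg : a + b + c = (3 : ℝ) • g := (smul_inv_smul₀ three_ne_zero _).symm
  have hpos : 0 < ω (g - a) (b - g) := by linarith [areaForm_eq_neg_three_mul_of_add_add_eq hg]
  set t := √(ω (g - a) (b - g))
  have ht : t ≠ 0 := (Real.sqrt_pos.2 hpos).ne'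
  have hω : ω (t⁻¹ • (g - a)) (t⁻¹ • (b - g)) = 1 := by
    rw [map_smul, map_smul, LinearMap.smul_apply, smul_eq_mul, smul_eq_mul, ← mul_assoc,
      ← mul_inv, Real.mul_self_sqrt hpos.le, inv_mul_cancel₀ hpos.ne']
  obtain ⟨D₁, D₂, D₃, θ₁, θ₂, θ₃, htriple, hu, hw⟩ := exists_tangentTriple ⟨0, 1, one_pos⟩ hω
  obtain ⟨γ₁₂, γ₂₃, γ₃₁, hC, rfl, rfl, rfl⟩ :=
    htriple.exists_isApollonianConfiguration (t := t) hg (by rw [hu, smul_inv_smul₀ ht])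
      (by rw [hw, smul_inv_smul₀ ht])
  exact ⟨_, _, _, _, _, _, _, _, _, _, _, hC, rfl, rfl⟩

lemma areaForm_ne_zero_of_affineIndependent (h : AffineIndependent ℝ ![a, b, c]) :
    ω (b - a) (c - a) ≠ 0 := by
  intro hω
  have hba : b - a ≠ 0 := sub_ne_zero.2 (h.injective.ne (a₁ := 1) (a₂ := 0) (by decide))
  obtain ⟨r, hr⟩ := exists_eq_smul_of_areaForm_eq_zero hba hω
  refine affineIndependent_iff_not_collinear_set.1 h ?_
  refine (collinear_iff_of_mem (p₀ := a) (by simp)).2 ⟨b - a, ?_⟩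
  rintro p (rfl | rfl | rfl)
  · exact ⟨0, by simp⟩
  · exact ⟨1, by simp⟩
  · exact ⟨r, by rw [← hr, vadd_eq_add, sub_add_cancel]⟩

theorem exists_isApollonianTriangle (h : AffineIndependent ℝ ![a, b, c]) :
    ∃ T, IsApollonianTriangle T {a, b, c} := by
  rcases (areaForm_ne_zero_of_affineIndependent h).lt_or_gt with hneg | hpos
  · exact exists_isApollonianTriangle_of_areaForm_neg hneg
  · rw [pair_comm]
    refine exists_isApollonianTriangle_of_areaForm_neg ?_
    rwa [Complex.orientation.areaForm_swap, neg_lt_zero]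

end ApollonianTriangle

theorem theorem6 (v₁ v₂ v₃ : ℂ) (hv : AffineIndependent ℝ ![v₁, v₂, v₃]) :
    ∃! T : Set ℂ, IsApollonianTriangle T {v₁, v₂, v₃} := by
  have hcard : ({v₁, v₂, v₃} : Finset ℂ).card = 3 :=
    Finset.card_triple_eq_three_iff.2 ⟨hv.injective.ne (a₁ := 0) (a₂ := 1) (by decide),
      hv.injective.ne (a₁ := 0) (a₂ := 2) (by decide),
      hv.injective.ne (a₁ := 1) (a₂ := 2) (by decide)⟩
  refine existsUnique_of_exists_of_unique (exists_isApollonianTriangle hv) fun T T' hT hT' ↦ ?_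
  have hcoe : ({v₁, v₂, v₃} : Set ℂ) = ({v₁, v₂, v₃} : Finset ℂ) := by push_cast; rfl
  rw [hcoe] at hT hT'
  rw [hT.eq_enclosedRegion hcard, hT'.eq_enclosedRegion hcard]
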